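/- **Setting.** Let $V$ be a complex Hausdorff locally convex space whose topology is defined by the seminorms $\|v\|_\alpha=\sqrt{\langle v,v\rangle_\alpha}$, where $\langle\cdot,\cdot\rangle_\alpha$ runs over all continuous positive (semi-definite) Hermitian forms on $V$ (antilinear in the first argument). On $\mathcal T^\bullet(V)=\bigoplus_{k\ge 0}V^{\otimes k}$ (algebraic tensor powers) put the locally convex topology defined by the seminorms of the sesquilinear extensions $$\langle X,Y\rangle_\alpha^\bullet=\sum_{k\ge0}\langle X_k,Y_k\rangle^\bullet_\alpha,\qquad \langle x_1\otimes\cdots\otimes x_k,\,y_1\otimes\cdots\otimes y_k\rangle^\bullet_\alpha=k!\prod_{m=1}^k\langle x_m,y_m\rangle_\alpha .$$ Let $\mathcal S^\bullet(V)\subseteq\mathcal T^\bullet(V)$ be the space of symmetric tensors, i.e. the image of the symmetrisation projector $\mathscr S$, with the subspace topology, and let $\mathcal S^\bullet(V)^{\mathrm{cpl}}$ be its completion. For a bilinear form $\Lambda$ on $V$ and $X,Y\in\mathcal S^\bullet(V)$ let $$X\star_\Lambda Y=\sum_{t=0}^\infty\frac1{t!}\,\mu_\vee\big((P_\Lambda)^t(X\otimes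 Y)\big),\qquad \mu_\vee(X\otimes Y)=\mathscr S(X\otimes Y),$$ where $P_\Lambda\big((x_1\otimes\cdots\otimes x_k)\otimes(y_1\otimes\cdots\otimes y_\ell)\big)=k\ell\,\Lambda(x_k,y_1)\,(x_1\otimes\cdots\otimes x_{k-1})\otimes(y_2\otimes\cdots\otimes y_\ell)$ for $k,\ell\ge1$, and $P_\Lambda=0$ if $k=0$ or $\ell=0$. For a bilinear form $b$ on $V$ let $\Delta_b$ be the linear operator on $\mathcal T^\bullet(V)$ with $\Delta_b(x_1\otimes\cdots\otimes x_k)=\frac{k(k-1)}2\,b(x_1,x_2)\,x_3\otimes\cdots\otimes x_k$ for $k\ge2$ and $\Delta_b=0$ in degrees $0,1$; it maps $\mathcal S^\bullet(V)$ into itself. Put $e^{\Delta_b}=\sum_{t\ge0}\frac1{t!}(\Delta_b)^t$ (a finite sum on every vector). The form $b$ is *of Hilbert–Schmidt type* if there is a continuous positive Hermitian form $\langle\cdot,\cdot\rangle_\alpha$ on $V$ such that $b(v,w)=0$ whenever $\|v\|_\alpha=0$ or $\|w\|_\alpha=0$, and $\sum_{i,j=1}^d|b(e_i,e_j)|^2\le1$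 for every finite $\langle\cdot,\cdot\rangle_\alpha$-orthonormal tuple $(e_1,\dots,e_d)$ in $V$. **Theorem.** Let $b$ be a symmetric (not necessarily continuous) bilinear form on $V$. 1. $e^{\Delta_b}\colon\mathcal T^\bullet(V)\to\mathcal T^\bullet(V)$ is continuous if and only if $b$ is of Hilbert–Schmidt type; likewise, the restriction of $e^{\Delta_b}$ to $\mathcal S^\bullet(V)$ is continuous if and only if $b$ is of Hilbert–Schmidt type. Assume from now on that $b$ is of Hilbert–Schmidt type. 2. For every continuous bilinear form $\Lambda$ on $V$, the form $\Lambda+b$ is continuous and $$e^{\Delta_b}(X\star_\Lambda Y)=\big(e^{\Delta_b}X\big)\star_{\Lambda+b}\big(e^{\Delta_b}Y\big)\qquad\text{for all }X,Y\in\mathcal S^\bullet(V).$$ 3. Hence, for every continuous bilinear form $\Lambda$ on $V$, the restriction of $e^{\Delta_b}$ is an isomorphism of the locally convex algebras $(\mathcal S^\bullet(V),\star_\Lambda)$ and $(\mathcal S^\bullet(V),\star_{\Lambda+b})$, i.e. a linear homeomorphism of $\mathcal S^\bullet(V)$ onto itself that carries $\star_\Lambda$ to $\star_{\Lambda+b}$.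 4. $\Delta_b$ extends to a continuous linear operator, again denoted by $\Delta_b$, on $\mathcal S^\bullet(V)^{\mathrm{cpl}}$. For every $X\in\mathcal S^\bullet(V)^{\mathrm{cpl}}$ the series $e^{z\Delta_b}X=\sum_{t=0}^\infty\frac{z^t}{t!}(\Delta_b)^tX$ converges absolutely (with respect to every continuous seminorm) for every $z\in\mathbb C$ and locally uniformly in $z\in\mathbb C$, and its sum is a holomorphic function of $z\in\mathbb C$ with values in $\mathcal S^\bullet(V)^{\mathrm{cpl}}$. -/

import Mathlib

open scoped TensorProduct ComplexConjugate DirectSum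

noncomputable section

namespace HilbertTensor

/-! ### Positive Hermitian forms and their seminorms -/

/-- A sesquilinear form (antilinear in the first argument) which is Hermitian and positive
semi-definite. -/
structure IsPosHermitian {E : Type*} [AddCommGroup E] [Module ℂ E]
    (f : E →ₗ⋆[ℂ] E →ₗ[ℂ] ℂ) : Prop where
  conj_symm : ∀ v w, conj (f v w) = f w v
  nonneg : ∀ v, 0 ≤ (f v v).re

/-- The pre-inner product given by a positive Hermitian form. -/
abbrev IsPosHermitian.core {E : Type*} [AddCommGroup E] [Module ℂ E]
    {f : E →ₗ⋆[ℂ] E →ₗ[ℂ] ℂ} (hf : IsPosHermitian f) : PreInnerProductSpace.Core ℂ E where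
  inner v w := f v w
  conj_inner_symm v w := hf.conj_symm w v
  re_inner_nonneg v := hf.nonneg v
  add_left u v w := by simp
  smul_left u v r := by simp

/-- The Hilbert seminorm `v ↦ √⟨v, v⟩` of a positive Hermitian form. -/
def IsPosHermitian.seminorm {E : Type*} [AddCommGroup E] [Module ℂ E]
    {f : E →ₗ⋆[ℂ] E →ₗ[ℂ] ℂ} (hf : IsPosHermitian f) : Seminorm ℂ E :=
  Seminorm.of (fun v => √(f v v).re)
    (by
      let := hf.core
      let : SeminormedAddCommGroup E := InnerProductSpace.Core.toSeminormedAddCommGroup (𝕜 := ℂ)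
      intro v w
      exact norm_add_le v w)
    (by
      let := hf.core
      let : SeminormedAddCommGroup E := InnerProductSpace.Core.toSeminormedAddCommGroup (𝕜 := ℂ)
      let : NormedSpace ℂ E := InnerProductSpace.Core.toNormedSpace
      intro a v
      exact norm_smul a v)

/-- The set of continuous positive Hermitian forms on `V`. -/
structure ContForm (V : Type*) [AddCommGroup V] [Module ℂ V] [TopologicalSpace V] where
  /-- the sesquilinear form, antilinear in the first argument -/
  form : V →ₗ⋆[ℂ] V →ₗ[ℂ] ℂ
  isPosHermitian : IsPosHermitian form
  continuous_form : Continuous fun p : V × V => form p.1 p.2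

instance (V : Type*) [AddCommGroup V] [Module ℂ V] [TopologicalSpace V] :
    Nonempty (ContForm V) :=
  ⟨⟨0, ⟨by simp, by simp⟩, by simpa using continuous_const⟩⟩

/-- The family of all continuous Hilbert seminorms on `V`. -/
def hilbertSeminorms (V : Type*) [AddCommGroup V] [Module ℂ V] [TopologicalSpace V] :
    SeminormFamily ℂ V (ContForm V) :=
  fun α => α.isPosHermitian.seminorm

/-! ### The tensor algebra and the extended forms -/

/-- The vector space `⨁ₖ V^{⊗k}` underlying the tensor algebra. -/
abbrev Tens (V : Type*) [AddCommGroup V] [Module ℂ V] : Type _ :=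
  ⨁ k : ℕ, ⨂[ℂ]^k V

section Algebraic

variable {V : Type*} [AddCommGroup V] [Module ℂ V]

/-- The linear functional `x₁ ⊗ ⋯ ⊗ xₖ ↦ ∏ₘ ⟨yₘ, xₘ⟩` on `V^{⊗k}`. -/
def prodFunctional (f : V →ₗ⋆[ℂ] V →ₗ[ℂ] ℂ) {k : ℕ} (y : Fin k → V) : (⨂[ℂ]^k V) →ₗ[ℂ] ℂ :=
  PiTensorProduct.lift
    ((MultilinearMap.mkPiAlgebra ℂ (Fin k) ℂ).compLinearMap fun m => f (y m))

theorem prodFunctional_tprod (f : V →ₗ⋆[ℂ] V →ₗ[ℂ] ℂ) {k : ℕ} (y x : Fin k → V) :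
    prodFunctional f y (PiTensorProduct.tprod ℂ x) = ∏ m, f (y m) (x m) := by
  simp [prodFunctional]

theorem apply_update (f : V →ₗ⋆[ℂ] V →ₗ[ℂ] ℂ) {k : ℕ} [DecidableEq (Fin k)]
    (y x : Fin k → V) (i : Fin k) (v : V) :
    ∏ m, f (Function.update y i v m) (x m) = f v (x i) * ∏ m ∈ {i}ᶜ, f (y m) (x m) := by
  rw [Fintype.prod_eq_mul_prod_compl i]
  simp only [Function.update_self]
  congr 1
  refine Finset.prod_congr rfl fun m hm => ?_
  have : m ≠ i := by simpa using hm
  simp [this]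

theorem prodFunctional_update_add (f : V →ₗ⋆[ℂ] V →ₗ[ℂ] ℂ) {k : ℕ} [DecidableEq (Fin k)]
    (y : Fin k → V) (i : Fin k) (v w : V) :
    prodFunctional f (Function.update y i (v + w)) =
      prodFunctional f (Function.update y i v) + prodFunctional f (Function.update y i w) := by
  ext x
  simp only [LinearMap.compMultilinearMap_apply, LinearMap.add_apply, prodFunctional_tprod,
    apply_update, map_add, add_mul]

theorem prodFunctional_update_smul (f : V →ₗ⋆[ℂ] V →ₗ[ℂ] ℂ) {k : ℕ} [DecidableEq (Fin k)]
    (y : Fin k → V) (i : Fin k) (c : ℂ) (v : V) :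
    prodFunctional f (Function.update y i (c • v)) =
      conj c • prodFunctional f (Function.update y i v) := by
  ext x
  simp only [LinearMap.compMultilinearMap_apply, LinearMap.smul_apply, prodFunctional_tprod,
    apply_update, map_smulₛₗ, smul_eq_mul, mul_assoc]

/-- The sesquilinear form on `V^{⊗k}` with
`⟨x₁ ⊗ ⋯ ⊗ xₖ, y₁ ⊗ ⋯ ⊗ yₖ⟩ = ∏ₘ ⟨xₘ, yₘ⟩` for a Hermitian form `⟨·, ·⟩` on `V`. It is the linear
extension in `y` of the map `(X, y) ↦ conj (∏ₘ ⟨yₘ, Xₘ⟩)`. -/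
def powForm (f : V →ₗ⋆[ℂ] V →ₗ[ℂ] ℂ) (k : ℕ) :
    (⨂[ℂ]^k V) →ₗ⋆[ℂ] (⨂[ℂ]^k V) →ₗ[ℂ] ℂ :=
  (PiTensorProduct.lift (R := ℂ) (E := (⨂[ℂ]^k V) →ₗ⋆[ℂ] ℂ)
    (MultilinearMap.mk' (fun y : Fin k → V =>
      ((starLinearEquiv ℂ (A := ℂ)).toLinearMap.comp (prodFunctional f y) :
        (⨂[ℂ]^k V) →ₗ⋆[ℂ] ℂ))
      (fun y i v w => by
        ext X
        simp [prodFunctional_update_add])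
      (fun y i c v => by
        ext X
        simp [prodFunctional_update_smul]))).flip

theorem powForm_tprod {f : V →ₗ⋆[ℂ] V →ₗ[ℂ] ℂ} (hf : IsPosHermitian f) {k : ℕ}
    (x y : Fin k → V) :
    powForm f k (PiTensorProduct.tprod ℂ x) (PiTensorProduct.tprod ℂ y) = ∏ m, f (x m) (y m) := by
  rw [powForm, LinearMap.flip_apply, PiTensorProduct.lift.tprod]
  simp [prodFunctional_tprod, hf.conj_symm]

/-- The form on the tensor algebra:
`⟨X, Y⟩ = ∑ₖ k! ⟨Xₖ, Yₖ⟩`, where `Xₖ` is the component of degree `k`. -/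
def extForm (f : V →ₗ⋆[ℂ] V →ₗ[ℂ] ℂ) : Tens V →ₗ⋆[ℂ] Tens V →ₗ[ℂ] ℂ where
  toFun X := DirectSum.toModule ℂ ℕ ℂ fun k => (k.factorial : ℂ) • powForm f k (X k)
  map_add' X Y := by
    ext k : 1
    ext y
    simp
  map_smul' c X := by
    ext k : 1
    ext y
    simp [DirectSum.smul_apply, mul_left_comm]

theorem extForm_apply (f : V →ₗ⋆[ℂ] V →ₗ[ℂ] ℂ) (X Y : Tens V) (s : Finset ℕ)
    (hs : ∀ k ∉ s, Y k = 0) :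
    extForm f X Y = ∑ k ∈ s, (k.factorial : ℂ) * powForm f k (X k) (Y k) := by
  classical
  have hY : Y = ∑ k ∈ s, DirectSum.lof ℂ ℕ (fun k => ⨂[ℂ]^k V) k (Y k) := by
    ext k : 1
    rw [DirectSum.sum_apply]
    by_cases hk : k ∈ s
    · rw [Finset.sum_eq_single_of_mem k hk, DirectSum.lof_apply]
      intro j _ hj
      exact DirectSum.of_eq_of_ne _ _ _ hj.symm
    · rw [hs k hk, Finset.sum_eq_zero]
      intro j hj
      have : k ≠ j := fun h => hk (h ▸ hj)
      exact DirectSum.of_eq_of_ne _ _ _ this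
  conv_lhs => rw [hY]
  simp [extForm]

open scoped ComplexOrder in
/-- The Gram matrix of a positive Hermitian form. -/
theorem gram_posSemidef {f : V →ₗ⋆[ℂ] V →ₗ[ℂ] ℂ} (hf : IsPosHermitian f) {ι : Type*} (e : ι → V) :
    (Matrix.of fun i j => f (e i) (e j)).PosSemidef := by
  refine ⟨?_, fun c => ?_⟩
  · ext i j
    simpa using hf.conj_symm (e j) (e i)
  · have h : (c.sum fun i ci => c.sum fun j cj => star ci * f (e i) (e j) * cj) =
        f (c.sum fun i ci => ci • e i) (c.sum fun i ci => ci • e i) := by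
      simp only [Finsupp.sum, map_sum, LinearMap.sum_apply, map_smulₛₗ, LinearMap.smul_apply,
        smul_eq_mul, Finset.mul_sum]
      rw [Finset.sum_comm]
      refine Finset.sum_congr rfl fun i _ => Finset.sum_congr rfl fun j _ => ?_
      simp [mul_comm, mul_left_comm]
    simp only [Matrix.of_apply]
    rw [h]
    set v := c.sum fun i ci => ci • e i
    have him := Complex.conj_eq_iff_im.1 (hf.conj_symm v v)
    exact Complex.nonneg_iff.2 ⟨hf.nonneg v, him.symm⟩

open scoped ComplexOrder in
theorem prod_gram_posSemidef {f : V →ₗ⋆[ℂ] V →ₗ[ℂ] ℂ} (hf : IsPosHermitian f) {k : ℕ}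
    (s : Finset (Fin k)) :
    (Matrix.of fun x y : Fin k → V => ∏ m ∈ s, f (x m) (y m)).PosSemidef := by
  classical
  induction s using Finset.induction_on with
  | empty =>
    refine ⟨by ext; simp, fun c => ?_⟩
    have h : (c.sum fun i ci => c.sum fun j cj => star ci * (1 : ℂ) * cj) =
        star (c.sum fun _ ci => ci) * c.sum fun _ ci => ci := by
      simp only [Finsupp.sum, star_sum, Finset.sum_mul_sum, mul_one]
    simp only [Finset.prod_empty, Matrix.of_apply]
    rw [h]
    exact star_mul_self_nonneg _
  | insert a s ha ih =>
    have h : (Matrix.of fun x y : Fin k → V => ∏ m ∈ insert a s, f (x m) (y m)) =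
        (Matrix.of fun x y : Fin k → V => f (x a) (y a)).hadamard
          (Matrix.of fun x y : Fin k → V => ∏ m ∈ s, f (x m) (y m)) := by
      ext x y
      simp [Finset.prod_insert ha]
    rw [h]
    exact (gram_posSemidef hf fun x : Fin k → V => x a).hadamard ih

theorem exists_eq_sum_tprod {k : ℕ} (X : ⨂[ℂ]^k V) :
    ∃ c : (Fin k → V) →₀ ℂ, X = c.sum fun x a => a • PiTensorProduct.tprod ℂ x := by
  have hX : X ∈ Submodule.span ℂ (Set.range (PiTensorProduct.tprod ℂ (s := fun _ : Fin k => V))) := by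
    rw [PiTensorProduct.span_tprod_eq_top]
    trivial
  obtain ⟨c, hc⟩ := (Finsupp.mem_span_range_iff_exists_finsupp).1 hX
  exact ⟨c, hc.symm⟩

open scoped ComplexOrder in
theorem powForm_isPosHermitian {f : V →ₗ⋆[ℂ] V →ₗ[ℂ] ℂ} (hf : IsPosHermitian f) (k : ℕ) :
    IsPosHermitian (powForm f k) where
  conj_symm X Y := by
    obtain ⟨c, rfl⟩ := exists_eq_sum_tprod X
    obtain ⟨d, rfl⟩ := exists_eq_sum_tprod Y
    simp only [Finsupp.sum, map_sum, LinearMap.sum_apply, map_smulₛₗ, LinearMap.smul_apply,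
      smul_eq_mul, powForm_tprod hf, map_mul, map_prod, hf.conj_symm, Finset.mul_sum]
    rw [Finset.sum_comm]
    refine Finset.sum_congr rfl fun i _ => Finset.sum_congr rfl fun j _ => ?_
    simp [mul_left_comm]
  nonneg X := by
    obtain ⟨c, rfl⟩ := exists_eq_sum_tprod X
    have h := (prod_gram_posSemidef hf (Finset.univ : Finset (Fin k))).2 c
    have h2 : (c.sum fun i ci => c.sum fun j cj => star ci *
          (Matrix.of fun x y : Fin k → V => ∏ m, f (x m) (y m)) i j * cj) =
        powForm f k (c.sum fun x a => a • PiTensorProduct.tprod ℂ x)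
          (c.sum fun x a => a • PiTensorProduct.tprod ℂ x) := by
      simp only [Finsupp.sum, map_sum, LinearMap.sum_apply, map_smulₛₗ, LinearMap.smul_apply,
        smul_eq_mul, powForm_tprod hf, Finset.mul_sum, Matrix.of_apply]
      rw [Finset.sum_comm]
      refine Finset.sum_congr rfl fun i _ => Finset.sum_congr rfl fun j _ => ?_
      simp [mul_comm, mul_left_comm]
    rw [← h2]
    exact (Complex.nonneg_iff.1 h).1

theorem extForm_isPosHermitian {f : V →ₗ⋆[ℂ] V →ₗ[ℂ] ℂ} (hf : IsPosHermitian f) :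
    IsPosHermitian (extForm f) where
  conj_symm X Y := by
    classical
    have hX : ∀ k ∉ DFinsupp.support X ∪ DFinsupp.support Y, X k = 0 := by
      intro k hk
      simp only [Finset.mem_union, not_or, DFinsupp.notMem_support_iff] at hk
      exact hk.1
    have hY : ∀ k ∉ DFinsupp.support X ∪ DFinsupp.support Y, Y k = 0 := by
      intro k hk
      simp only [Finset.mem_union, not_or, DFinsupp.notMem_support_iff] at hk
      exact hk.2
    rw [extForm_apply f X Y _ hY, extForm_apply f Y X _ hX, map_sum]
    refine Finset.sum_congr rfl fun k _ => ?_
    rw [map_mul, (powForm_isPosHermitian hf k).conj_symm]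
    simp
  nonneg X := by
    classical
    rw [extForm_apply f X X (DFinsupp.support X) fun k hk => DFinsupp.notMem_support_iff.1 hk,
      Complex.re_sum]
    refine Finset.sum_nonneg fun k _ => ?_
    rw [← Complex.ofReal_natCast, Complex.re_ofReal_mul]
    exact mul_nonneg (Nat.cast_nonneg _) ((powForm_isPosHermitian hf k).nonneg _)

end Algebraic

/-- The seminorms `X ↦ √⟨X, X⟩` on the tensor algebra extending the continuous Hilbert seminorms
on `V`. -/
def tensSeminorms (V : Type*) [AddCommGroup V] [Module ℂ V] [TopologicalSpace V] :
    SeminormFamily ℂ (Tens V) (ContForm V) :=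
  fun α => (extForm_isPosHermitian α.isPosHermitian).seminorm

section Topology

variable {V : Type*} [AddCommGroup V] [Module ℂ V] [TopologicalSpace V]

/-- The locally convex topology (with its uniform structure) on the tensor algebra, defined by the
extensions of all continuous Hilbert seminorms on `V`. -/
instance : UniformSpace (Tens V) :=
  (tensSeminorms V).addGroupFilterBasis.uniformSpace

theorem withSeminorms_tens : WithSeminorms (tensSeminorms V) := ⟨rfl⟩

instance : IsUniformAddGroup (Tens V) :=
  (tensSeminorms V).addGroupFilterBasis.isUniformAddGroup

instance : ContinuousSMul ℂ (Tens V) := withSeminorms_tens.continuousSMul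

end Topology

/-! ### Exponential series of locally nilpotent operators -/

section Exponential

variable {E : Type*} [AddCommMonoid E] [Module ℂ E]

/-- Every vector is annihilated by some power of `D`. -/
def LocallyNilpotent (D : E →ₗ[ℂ] E) : Prop := ∀ X, ∃ N, (D ^ N) X = 0

theorem pow_apply_eq_zero_of_le {D : E →ₗ[ℂ] E} {X : E} {N M : ℕ} (h : (D ^ N) X = 0)
    (hNM : N ≤ M) : (D ^ M) X = 0 := by
  obtain ⟨j, rfl⟩ := Nat.exists_eq_add_of_le' hNM
  rw [pow_add, Module.End.mul_apply, h, map_zero]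

theorem exists_pow_add {D : E →ₗ[ℂ] E} {X Y : E} (hX : ∃ N, (D ^ N) X = 0)
    (hY : ∃ N, (D ^ N) Y = 0) : ∃ N, (D ^ N) (X + Y) = 0 := by
  obtain ⟨N, hN⟩ := hX
  obtain ⟨M, hM⟩ := hY
  refine ⟨max N M, ?_⟩
  rw [map_add, pow_apply_eq_zero_of_le hN (le_max_left _ _),
    pow_apply_eq_zero_of_le hM (le_max_right _ _), add_zero]

theorem exists_pow_of_apply {D : E →ₗ[ℂ] E} {X : E} (h : ∃ N, (D ^ N) (D X) = 0) :
    ∃ N, (D ^ N) X = 0 := by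
  obtain ⟨N, hN⟩ := h
  exact ⟨N + 1, by rw [pow_succ, Module.End.mul_apply, hN]⟩

theorem LocallyNilpotent.finite_support {D : E →ₗ[ℂ] E} (hD : LocallyNilpotent D) (X : E) :
    (Function.support fun t : ℕ => ((t.factorial : ℂ)⁻¹) • (D ^ t) X).Finite := by
  obtain ⟨N, hN⟩ := hD X
  refine (Set.finite_lt_nat N).subset fun t ht => ?_
  by_contra h
  exact ht (by simp [pow_apply_eq_zero_of_le hN (not_lt.1 h)])

/-- The exponential `e^D = ∑ₜ (1/t!) D^t` of a locally nilpotent operator; for every vector the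
sum has only finitely many nonzero terms. -/
def LocallyNilpotent.exp {D : E →ₗ[ℂ] E} (hD : LocallyNilpotent D) : E →ₗ[ℂ] E where
  toFun X := ∑ᶠ t : ℕ, ((t.factorial : ℂ)⁻¹) • (D ^ t) X
  map_add' X Y := by
    rw [← finsum_add_distrib (hD.finite_support X) (hD.finite_support Y)]
    simp only [map_add, smul_add]
  map_smul' c X := by
    rw [RingHom.id_apply, smul_finsum' c (hD.finite_support X)]
    simp only [map_smul, smul_comm c]

theorem LocallyNilpotent.exp_mem {D : E →ₗ[ℂ] E} (hD : LocallyNilpotent D) (S : Submodule ℂ E)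
    (hS : ∀ X ∈ S, D X ∈ S) {X : E} (hX : X ∈ S) : hD.exp X ∈ S := by
  refine finsum_induction (· ∈ S) S.zero_mem (fun _ _ => S.add_mem) fun t => S.smul_mem _ ?_
  induction t with
  | zero => simpa using hX
  | succ t ih =>
    rw [pow_succ', Module.End.mul_apply]
    exact hS _ ih

end Exponential

/-! ### Symmetric tensors, star products and Laplace operators -/

section Operators

variable {V : Type*} [AddCommGroup V] [Module ℂ V]

/-- The inclusion of the tensors of degree `k` into the tensor algebra. -/
abbrev incl (k : ℕ) : (⨂[ℂ]^k V) →ₗ[ℂ] Tens V := DirectSum.lof ℂ ℕ (fun k => ⨂[ℂ]^k V) k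

/-- The permutation action `(x₁ ⊗ ⋯ ⊗ xₖ)^σ = x_{σ(1)} ⊗ ⋯ ⊗ x_{σ(k)}`. -/
def permute {k : ℕ} (σ : Equiv.Perm (Fin k)) : (⨂[ℂ]^k V) →ₗ[ℂ] (⨂[ℂ]^k V) :=
  (PiTensorProduct.reindex ℂ (fun _ => V) σ.symm).toLinearMap

theorem permute_tprod {k : ℕ} (σ : Equiv.Perm (Fin k)) (x : Fin k → V) :
    permute σ (PiTensorProduct.tprod ℂ x) = PiTensorProduct.tprod ℂ fun i => x (σ i) := by
  rw [permute, LinearEquiv.coe_coe, PiTensorProduct.reindex_tprod]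
  rfl

/-- Symmetrisation in degree `k`: `X ↦ (1/k!) ∑_σ X^σ`. -/
def symPow (k : ℕ) : (⨂[ℂ]^k V) →ₗ[ℂ] (⨂[ℂ]^k V) :=
  ((k.factorial : ℂ)⁻¹) • ∑ σ : Equiv.Perm (Fin k), permute σ

variable (V) in
/-- The symmetrisation operator on the tensor algebra. -/
def symmetrizer : Tens V →ₗ[ℂ] Tens V :=
  DirectSum.toModule ℂ ℕ (Tens V) fun k => incl k ∘ₗ symPow k

variable (V) in
/-- The space of symmetric tensors, the image of the symmetrisation operator. -/
def SymTens : Submodule ℂ (Tens V) := LinearMap.range (symmetrizer V)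

/-- The map `x₁ ⊗ ⋯ ⊗ x_{k+1} ↦ (x₂ ⊗ ⋯ ⊗ x_{k+1}) ⊗ x₁`. -/
def splitFirst (k : ℕ) : (⨂[ℂ]^(k + 1) V) →ₗ[ℂ] (⨂[ℂ]^k V) ⊗[ℂ] V :=
  PiTensorProduct.lift (LinearMap.uncurryLeft (M := fun _ : Fin (k + 1) => V)
    ((PiTensorProduct.lift (R := ℂ) (s := fun _ : Fin k => V)).symm.toLinearMap ∘ₗ
      (TensorProduct.mk ℂ (⨂[ℂ]^k V) V).flip))

/-- The map `x₁ ⊗ ⋯ ⊗ x_{k+1} ↦ (x₁ ⊗ ⋯ ⊗ xₖ) ⊗ x_{k+1}`. -/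
def splitLast (k : ℕ) : (⨂[ℂ]^(k + 1) V) →ₗ[ℂ] (⨂[ℂ]^k V) ⊗[ℂ] V :=
  PiTensorProduct.lift (MultilinearMap.uncurryRight (M := fun _ : Fin (k + 1) => V)
    ((TensorProduct.mk ℂ (⨂[ℂ]^k V) V).compMultilinearMap (PiTensorProduct.tprod ℂ)))

theorem splitFirst_tprod (k : ℕ) (x : Fin (k + 1) → V) :
    splitFirst k (PiTensorProduct.tprod ℂ x) =
      (PiTensorProduct.tprod ℂ fun i : Fin k => x i.succ) ⊗ₜ[ℂ] x 0 := by
  simp [splitFirst]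
  rfl

theorem splitLast_tprod (k : ℕ) (x : Fin (k + 1) → V) :
    splitLast k (PiTensorProduct.tprod ℂ x) =
      (PiTensorProduct.tprod ℂ fun i : Fin k => x i.castSucc) ⊗ₜ[ℂ] x (Fin.last k) := by
  simp [splitLast]
  rfl

/-- The contraction `(A ⊗ v) ⊗ (B ⊗ w) ↦ Λ(v, w) A ⊗ B`. -/
def pairing (Λ : LinearMap.BilinForm ℂ V) (k l : ℕ) :
    ((⨂[ℂ]^k V) ⊗[ℂ] V) ⊗[ℂ] ((⨂[ℂ]^l V) ⊗[ℂ] V) →ₗ[ℂ] (⨂[ℂ]^k V) ⊗[ℂ] (⨂[ℂ]^l V) :=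
  (TensorProduct.rid ℂ _).toLinearMap ∘ₗ
    TensorProduct.map LinearMap.id (TensorProduct.lift Λ) ∘ₗ
      (TensorProduct.tensorTensorTensorComm ℂ (⨂[ℂ]^k V) V (⨂[ℂ]^l V) V).toLinearMap

/-- The operator `P_Λ` in degrees `k` and `l`, with values in the tensor square of the tensor
algebra:
`(x₁ ⊗ ⋯ ⊗ xₖ) ⊗ (y₁ ⊗ ⋯ ⊗ y_l) ↦ k l Λ(xₖ, y₁) (x₁ ⊗ ⋯ ⊗ xₖ₋₁) ⊗ (y₂ ⊗ ⋯ ⊗ y_l)`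
for `k, l ≥ 1`, and zero if `k = 0` or `l = 0`. -/
def poissonDeg (Λ : LinearMap.BilinForm ℂ V) :
    (k l : ℕ) → (⨂[ℂ]^k V) ⊗[ℂ] (⨂[ℂ]^l V) →ₗ[ℂ] Tens V ⊗[ℂ] Tens V
  | k + 1, l + 1 => (((k + 1) * (l + 1) : ℕ) : ℂ) •
      (TensorProduct.map (incl k) (incl l) ∘ₗ pairing Λ k l ∘ₗ
        TensorProduct.map (splitLast k) (splitFirst l))
  | _, _ => 0

/-- The operator `P_Λ` on the tensor square of the tensor algebra. -/
def poisson (Λ : LinearMap.BilinForm ℂ V) : Tens V ⊗[ℂ] Tens V →ₗ[ℂ] Tens V ⊗[ℂ] Tens V :=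
  TensorProduct.lift
    (DirectSum.toModule ℂ ℕ (Tens V →ₗ[ℂ] Tens V ⊗[ℂ] Tens V) fun k =>
      (DirectSum.toModule ℂ ℕ ((⨂[ℂ]^k V) →ₗ[ℂ] Tens V ⊗[ℂ] Tens V) fun l =>
        (TensorProduct.curry (poissonDeg Λ k l)).flip).flip)

theorem poisson_map (Λ : LinearMap.BilinForm ℂ V) (k l : ℕ) (Z : (⨂[ℂ]^k V) ⊗[ℂ] (⨂[ℂ]^l V)) :
    poisson Λ (TensorProduct.map (incl k) (incl l) Z) = poissonDeg Λ k l Z := by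
  have h : poisson Λ ∘ₗ TensorProduct.map (incl k) (incl l) = poissonDeg Λ k l := by
    refine TensorProduct.ext' fun x y => ?_
    simp [poisson]
  exact LinearMap.congr_fun h Z

theorem poisson_locallyNilpotent (Λ : LinearMap.BilinForm ℂ V) :
    LocallyNilpotent (poisson Λ) := by
  have key : ∀ (k l : ℕ) (Z : (⨂[ℂ]^k V) ⊗[ℂ] (⨂[ℂ]^l V)),
      ∃ N, (poisson Λ ^ N) (TensorProduct.map (incl k) (incl l) Z) = 0 := by
    intro k
    induction k with
    | zero =>
      intro l Z
      exact ⟨1, by rw [pow_one, poisson_map]; simp [poissonDeg]⟩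
    | succ k ih =>
      intro l Z
      cases l with
      | zero => exact ⟨1, by rw [pow_one, poisson_map]; simp [poissonDeg]⟩
      | succ l =>
        refine exists_pow_of_apply ?_
        rw [poisson_map]
        simp only [poissonDeg, LinearMap.smul_apply, LinearMap.comp_apply]
        obtain ⟨N, hN⟩ := ih l (pairing Λ k l (TensorProduct.map (splitLast k) (splitFirst l) Z))
        exact ⟨N, by rw [map_smul, hN, smul_zero]⟩
  intro Z
  induction Z using TensorProduct.induction_on with
  | zero => exact ⟨0, by simp⟩
  | add X Y hX hY => exact exists_pow_add hX hY
  | tmul X Y =>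
    induction X using DirectSum.induction_on with
    | zero => exact ⟨0, by simp⟩
    | add X X' hX hX' =>
      rw [TensorProduct.add_tmul]
      exact exists_pow_add hX hX'
    | of k x =>
      induction Y using DirectSum.induction_on with
      | zero => exact ⟨0, by simp⟩
      | add Y Y' hY hY' =>
        rw [TensorProduct.tmul_add]
        exact exists_pow_add hY hY'
      | of l y => exact key k l (x ⊗ₜ y)

/-- The undeformed product `X ⊗ Y ↦ X ∨ Y`, the symmetrisation of the product of the tensor
algebra, with values in the symmetric tensors. -/
def mulVee : Tens V ⊗[ℂ] Tens V →ₗ[ℂ] SymTens V :=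
  (symmetrizer V).rangeRestrict ∘ₗ LinearMap.mul' ℂ (Tens V)

/-- The star product on symmetric tensors,
`X ⋆_Λ Y = ∑ₜ (1/t!) μ_∨ ((P_Λ)^t (X ⊗ Y))`. -/
def starProd (Λ : LinearMap.BilinForm ℂ V) : SymTens V →ₗ[ℂ] SymTens V →ₗ[ℂ] SymTens V :=
  TensorProduct.curry (mulVee ∘ₗ (poisson_locallyNilpotent Λ).exp ∘ₗ
    TensorProduct.map (SymTens V).subtype (SymTens V).subtype)

/-- The contraction of the first two factors,
`x₁ ⊗ ⋯ ⊗ x_{k+2} ↦ b(x₁, x₂) x₃ ⊗ ⋯ ⊗ x_{k+2}`. -/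
def contractFirst (b : LinearMap.BilinForm ℂ V) (k : ℕ) : (⨂[ℂ]^(k + 2) V) →ₗ[ℂ] (⨂[ℂ]^k V) :=
  (TensorProduct.rid ℂ _).toLinearMap ∘ₗ
    TensorProduct.map LinearMap.id (TensorProduct.lift b.flip) ∘ₗ
      (TensorProduct.assoc ℂ (⨂[ℂ]^k V) V V).toLinearMap ∘ₗ
        TensorProduct.map (splitFirst k) LinearMap.id ∘ₗ splitFirst (k + 1)

theorem contractFirst_tprod (b : LinearMap.BilinForm ℂ V) (k : ℕ) (x : Fin (k + 2) → V) :
    contractFirst b k (PiTensorProduct.tprod ℂ x) =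
      b (x 0) (x 1) • PiTensorProduct.tprod ℂ fun i : Fin k => x i.succ.succ := by
  simp [contractFirst, splitFirst_tprod]

/-- The Laplace operator in degree `k`:
`x₁ ⊗ ⋯ ⊗ xₖ ↦ (k(k-1)/2) b(x₁, x₂) x₃ ⊗ ⋯ ⊗ xₖ` for `k ≥ 2`, and zero for `k = 0, 1`. -/
def laplaceDeg (b : LinearMap.BilinForm ℂ V) : (k : ℕ) → (⨂[ℂ]^k V) →ₗ[ℂ] Tens V
  | 0 => 0
  | 1 => 0
  | k + 2 => (((k + 2 : ℂ) * (k + 1)) / 2) • (incl k ∘ₗ contractFirst b k)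

/-- The Laplace operator `Δ_b` on the tensor algebra. -/
def laplace (b : LinearMap.BilinForm ℂ V) : Tens V →ₗ[ℂ] Tens V :=
  DirectSum.toModule ℂ ℕ (Tens V) (laplaceDeg b)

theorem laplace_locallyNilpotent (b : LinearMap.BilinForm ℂ V) :
    LocallyNilpotent (laplace b) := by
  have key : ∀ (k : ℕ) (x : ⨂[ℂ]^k V), ∃ N, (laplace b ^ N) (incl k x) = 0 := by
    intro k
    induction k using Nat.strong_induction_on with
    | _ k ih =>
      intro x
      match k with
      | 0 => exact ⟨1, by simp [laplace, laplaceDeg]⟩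
      | 1 => exact ⟨1, by simp [laplace, laplaceDeg]⟩
      | k + 2 =>
        refine exists_pow_of_apply ?_
        obtain ⟨N, hN⟩ := ih k (by omega) (contractFirst b k x)
        refine ⟨N, ?_⟩
        simp only [laplace, DirectSum.toModule_lof, laplaceDeg, LinearMap.smul_apply,
          LinearMap.comp_apply, map_smul]
        rw [← laplace, hN, smul_zero]
  intro X
  induction X using DirectSum.induction_on with
  | zero => exact ⟨0, by simp⟩
  | add X Y hX hY => exact exists_pow_add hX hY
  | of k x => exact key k x

/-- The operator `e^{Δ_b}` on the tensor algebra. -/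
def expLaplace (b : LinearMap.BilinForm ℂ V) : Tens V →ₗ[ℂ] Tens V :=
  (laplace_locallyNilpotent b).exp

theorem permute_symPow {k : ℕ} (τ : Equiv.Perm (Fin k)) (x : ⨂[ℂ]^k V) :
    permute τ (symPow k x) = symPow k x := by
  have h : permute τ ∘ₗ symPow k = symPow (V := V) k := by
    ext x
    simp only [LinearMap.compMultilinearMap_apply, LinearMap.comp_apply, symPow,
      LinearMap.smul_apply, LinearMap.sum_apply, map_smul, map_sum, permute_tprod]
    congr 1
    exact Fintype.sum_equiv (Equiv.mulRight τ) _ _ fun σ => rfl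
  exact LinearMap.congr_fun h x

theorem liftPerm_apply {k : ℕ} (τ : Equiv.Perm (Fin k)) :
    (Equiv.Perm.decomposeFin.symm (0, Equiv.Perm.decomposeFin.symm (0, τ)) : Equiv.Perm _) 0 = 0 ∧
    (Equiv.Perm.decomposeFin.symm (0, Equiv.Perm.decomposeFin.symm (0, τ)) : Equiv.Perm _) 1 = 1 ∧
    ∀ i : Fin k, (Equiv.Perm.decomposeFin.symm
      (0, Equiv.Perm.decomposeFin.symm (0, τ)) : Equiv.Perm _) i.succ.succ = (τ i).succ.succ := by
  refine ⟨?_, ?_, fun i => ?_⟩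
  · rw [Equiv.Perm.decomposeFin_symm_apply_zero]
  · rw [Equiv.Perm.decomposeFin_symm_apply_one, Equiv.Perm.decomposeFin_symm_apply_zero]
    simp
  · rw [Equiv.Perm.decomposeFin_symm_apply_succ, Equiv.Perm.decomposeFin_symm_apply_succ]
    simp

theorem contractFirst_permute (b : LinearMap.BilinForm ℂ V) {k : ℕ} (τ : Equiv.Perm (Fin k))
    (x : ⨂[ℂ]^(k + 2) V) :
    contractFirst b k (permute (Equiv.Perm.decomposeFin.symm
      (0, Equiv.Perm.decomposeFin.symm (0, τ))) x) = permute τ (contractFirst b k x) := by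
  have h : contractFirst b k ∘ₗ permute (Equiv.Perm.decomposeFin.symm
      (0, Equiv.Perm.decomposeFin.symm (0, τ))) = permute τ ∘ₗ contractFirst b k := by
    ext x
    obtain ⟨h0, h1, h2⟩ := liftPerm_apply τ
    simp only [LinearMap.compMultilinearMap_apply, LinearMap.comp_apply, permute_tprod,
      contractFirst_tprod, map_smul]
    rw [h0, h1]
    exact congrArg (fun y => b (x 0) (x 1) • PiTensorProduct.tprod ℂ y)
      (funext fun i => congrArg x (h2 i))
  exact LinearMap.congr_fun h x

theorem symPow_eq_self {k : ℕ} {x : ⨂[ℂ]^k V} (h : ∀ τ, permute τ x = x) : symPow k x = x := by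
  have hk : (k.factorial : ℂ) ≠ 0 := by exact_mod_cast k.factorial_ne_zero
  simp only [symPow, LinearMap.smul_apply, LinearMap.sum_apply, h, Finset.sum_const,
    Finset.card_univ, Fintype.card_perm, Fintype.card_fin]
  rw [← Nat.cast_smul_eq_nsmul ℂ, smul_smul, inv_mul_cancel₀ hk, one_smul]

theorem laplace_mem_sym (b : LinearMap.BilinForm ℂ V) {X : Tens V} (hX : X ∈ SymTens V) :
    laplace b X ∈ SymTens V := by
  obtain ⟨X, rfl⟩ := hX
  induction X using DirectSum.induction_on with
  | zero => simp
  | add X Y hX hY => simpa only [map_add] using (SymTens V).add_mem hX hY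
  | of k x =>
    rw [← DirectSum.lof_eq_of ℂ, symmetrizer, DirectSum.toModule_lof, LinearMap.comp_apply,
      laplace, DirectSum.toModule_lof]
    match k with
    | 0 => exact (SymTens V).zero_mem
    | 1 => exact (SymTens V).zero_mem
    | k + 2 =>
      refine (SymTens V).smul_mem _ ⟨incl k (contractFirst b k (symPow (k + 2) x)), ?_⟩
      rw [symmetrizer, DirectSum.toModule_lof, LinearMap.comp_apply, LinearMap.comp_apply,
        symPow_eq_self]
      intro τ
      rw [← contractFirst_permute, permute_symPow]

/-- The restriction of `Δ_b` to the symmetric tensors. -/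
def laplaceSym (b : LinearMap.BilinForm ℂ V) : SymTens V →ₗ[ℂ] SymTens V :=
  (laplace b).restrict fun _ hX => laplace_mem_sym b hX

/-- The restriction of `e^{Δ_b}` to the symmetric tensors. -/
def expLaplaceSym (b : LinearMap.BilinForm ℂ V) : SymTens V →ₗ[ℂ] SymTens V :=
  (expLaplace b).restrict fun _ hX =>
    (laplace_locallyNilpotent b).exp_mem (SymTens V) (fun _ => laplace_mem_sym b) hX

end Operators

section Topology

variable {V : Type*} [AddCommGroup V] [Module ℂ V] [TopologicalSpace V]

instance : IsUniformAddGroup (SymTens V) :=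
  (SymTens V).toAddSubgroup.isUniformAddGroup

instance : UniformContinuousConstSMul ℂ (SymTens V) :=
  uniformContinuousConstSMul_of_continuousConstSMul ℂ (SymTens V)

variable (V) in
/-- The completion of the space of symmetric tensors. -/
abbrev SymCpl : Type _ := UniformSpace.Completion (SymTens V)

end Topology

/-- A bilinear form `b` on `V` is of Hilbert–Schmidt type if there is a continuous positive
Hermitian form `α` such that `b(v, w) = 0` whenever `‖v‖_α = 0` or `‖w‖_α = 0`, and
`∑_{i,j} |b(eᵢ, eⱼ)|² ≤ 1` for every finite `α`-orthonormal tuple `e`. -/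
def IsHilbertSchmidt {V : Type*} [AddCommGroup V] [Module ℂ V] [TopologicalSpace V]
    (b : LinearMap.BilinForm ℂ V) : Prop :=
  ∃ α : ContForm V,
    (∀ v w, hilbertSeminorms V α v = 0 ∨ hilbertSeminorms V α w = 0 → b v w = 0) ∧
    ∀ (d : ℕ) (e : Fin d → V), (∀ i j, α.form (e i) (e j) = if i = j then 1 else 0) →
      ∑ i, ∑ j, ‖b (e i) (e j)‖ ^ 2 ≤ 1

end HilbertTensor

end

/-!
For a single continuous form `⟨·,·⟩_α` dominating `b` in the Hilbert–Schmidt sense, contraction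
with `b` is bounded by the Hilbert–Schmidt norm, and `e^{Δ_b}` and the series `e^{zΔ_b}` are
estimated by passing to a multiple of `⟨·,·⟩_α`. Conversely, continuity of `e^{Δ_b}` on symmetric
tensors of degree two bounds `b` as a functional on `V ⊗ V`, and testing it on
`∑ conj b(e_i, e_j) e_i ⊗ e_j` gives the Hilbert–Schmidt bound.

For the star products, symmetric tensors are spanned by divided powers `v^{⊗n} / n!`. Comparing
coefficients in `Δ_b ((s v + w)^{⊗n} / n!)` gives the Leibniz rule
`Δ_b ∘ ∨ = ∨ ∘ (Δ_b ⊗ 1 + 1 ⊗ Δ_b + P_b)`, whose summands commute with one another and with `P_Λ`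
on products of divided powers. Exponentiating turns `P_Λ` into `P_Λ + P_b = P_{Λ+b}`.
-/

noncomputable section

namespace HilbertTensor

section PositiveForms

variable {E : Type*} [AddCommGroup E] [Module ℂ E] {f g : E →ₗ⋆[ℂ] E →ₗ[ℂ] ℂ}

theorem IsPosHermitian.seminorm_apply (hf : IsPosHermitian f) (v : E) :
    hf.seminorm v = √(f v v).re :=
  rfl

theorem IsPosHermitian.seminorm_sq (hf : IsPosHermitian f) (v : E) :
    hf.seminorm v ^ 2 = (f v v).re :=
  Real.sq_sqrt (hf.nonneg v)

theorem IsPosHermitian.apply_self (hf : IsPosHermitian f) (v : E) :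
    f v v = ((f v v).re : ℂ) :=
  (Complex.conj_eq_iff_re.1 (hf.conj_symm v v)).symm

theorem IsPosHermitian.norm_apply_le (hf : IsPosHermitian f) (v w : E) :
    ‖f v w‖ ≤ hf.seminorm v * hf.seminorm w := by
  let := hf.core
  let : SeminormedAddCommGroup E := InnerProductSpace.Core.toSeminormedAddCommGroup (𝕜 := ℂ)
  exact InnerProductSpace.Core.norm_inner_le_norm v w

theorem IsPosHermitian.apply_eq_zero (hf : IsPosHermitian f) {v : E} (hv : hf.seminorm v = 0) :
    f v = 0 := by
  ext w
  simpa [hv] using hf.norm_apply_le v w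

theorem IsPosHermitian.add (hf : IsPosHermitian f) (hg : IsPosHermitian g) :
    IsPosHermitian (f + g) where
  conj_symm v w := by simp [hf.conj_symm, hg.conj_symm]
  nonneg v := by simpa using add_nonneg (hf.nonneg v) (hg.nonneg v)

theorem IsPosHermitian.smul (hf : IsPosHermitian f) {r : ℝ} (hr : 0 ≤ r) :
    IsPosHermitian ((r : ℂ) • f) where
  conj_symm v w := by simp [hf.conj_symm]
  nonneg v := by simpa using mul_nonneg hr (hf.nonneg v)

-- Lift an orthonormal basis of the span of `S` in the separation quotient.
theorem IsPosHermitian.exists_orthonormal_span (hf : IsPosHermitian f) (S : Finset E) :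
    ∃ (d : ℕ) (e : Fin d → E), (∀ i j, f (e i) (e j) = if i = j then 1 else 0) ∧
      ∀ v ∈ S, hf.seminorm (v - ∑ i, f (e i) v • e i) = 0 := by
  let := hf.core
  let : SeminormedAddCommGroup E := InnerProductSpace.Core.toSeminormedAddCommGroup (𝕜 := ℂ)
  let : InnerProductSpace ℂ E := InnerProductSpace.ofCore hf.core
  let mk : E →L[ℂ] SeparationQuotient E := SeparationQuotient.mkCLM ℂ E
  let W : Submodule ℂ (SeparationQuotient E) := Submodule.span ℂ (mk '' S)
  have : FiniteDimensional ℂ W := FiniteDimensional.span_of_finite ℂ (S.finite_toSet.image _)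
  let u := stdOrthonormalBasis ℂ W
  choose e he using fun i => SeparationQuotient.surjective_mk (u i : SeparationQuotient E)
  have inner_mk : ∀ v w : E, inner ℂ (mk v) (mk w) = f v w := fun _ _ => rfl
  refine ⟨_, e, fun i j => ?_, fun v hv => ?_⟩
  · rw [← inner_mk]
    simpa [mk, he] using orthonormal_iff_ite.1 u.orthonormal i j
  · let w : W := ⟨mk v, Submodule.subset_span ⟨v, hv, rfl⟩⟩
    have expansion : ∑ i, f (e i) v • mk (e i) = mk v := by
      have h := congrArg Subtype.val (u.sum_repr' w)
      rw [Submodule.coe_sum] at h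
      refine Eq.trans (Finset.sum_congr rfl fun i _ => ?_) h
      rw [← inner_mk]
      simp only [mk, SeparationQuotient.mkCLM_apply, he]
      rfl
    change ‖v - ∑ i, f (e i) v • e i‖ = 0
    rw [← SeparationQuotient.norm_mk, ← SeparationQuotient.mkCLM_apply ℂ, norm_eq_zero, map_sub,
      map_sum, sub_eq_zero]
    simpa only [map_smul] using expansion.symm

theorem sesq_finsuppSum (f : E →ₗ⋆[ℂ] E →ₗ[ℂ] ℂ) {ι : Type*} (c : ι →₀ ℂ) (x : ι → E) :
    f (c.sum fun i a => a • x i) (c.sum fun i a => a • x i) =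
      c.sum fun i ci => c.sum fun j cj => star ci * f (x i) (x j) * cj := by
  simp only [Finsupp.sum, map_sum, LinearMap.sum_apply, map_smulₛₗ, LinearMap.smul_apply,
    smul_eq_mul, Finset.mul_sum]
  rw [Finset.sum_comm]
  refine Finset.sum_congr rfl fun i _ => Finset.sum_congr rfl fun j _ => ?_
  simp [mul_comm, mul_left_comm]

open scoped ComplexOrder in
theorem re_apply_self_le_of_posSemidef {F : Type*} [AddCommGroup F] [Module ℂ F]
    {f : E →ₗ⋆[ℂ] E →ₗ[ℂ] ℂ} {g : F →ₗ⋆[ℂ] F →ₗ[ℂ] ℂ} {ι : Type*} {x : ι → E} {y : ι → F}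
    (h : (Matrix.of fun i j => g (y i) (y j) - f (x i) (x j)).PosSemidef) (c : ι →₀ ℂ) :
    (f (c.sum fun i a => a • x i) (c.sum fun i a => a • x i)).re ≤
      (g (c.sum fun i a => a • y i) (c.sum fun i a => a • y i)).re := by
  have h' := h.2 c
  simp only [Matrix.of_apply, mul_sub, sub_mul, Finsupp.sum_sub] at h'
  rw [sesq_finsuppSum f, sesq_finsuppSum g, ← sub_nonneg, ← Complex.sub_re]
  exact (Complex.nonneg_iff.1 h').1

end PositiveForms

section TensorPowers

variable {V : Type*} [AddCommGroup V] [Module ℂ V] {f g : V →ₗ⋆[ℂ] V →ₗ[ℂ] ℂ}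

open scoped ComplexOrder in
theorem prod_add_gram_sub_prod_gram_posSemidef (hf : IsPosHermitian f) (hg : IsPosHermitian g)
    {k : ℕ} (s : Finset (Fin k)) :
    (Matrix.of fun x y : Fin k → V =>
      ∏ m ∈ s, (f + g) (x m) (y m) - ∏ m ∈ s, f (x m) (y m)).PosSemidef := by
  classical
  induction s using Finset.induction_on with
  | empty =>
    simp only [Finset.prod_empty, sub_self]
    exact Matrix.PosSemidef.zero
  | insert a s ha ih =>
    have recursion : (Matrix.of fun x y : Fin k → V => ∏ m ∈ insert a s, (f + g) (x m) (y m) -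
          ∏ m ∈ insert a s, f (x m) (y m)) =
        (Matrix.of fun x y : Fin k → V => f (x a) (y a)).hadamard
          (Matrix.of fun x y : Fin k → V =>
            ∏ m ∈ s, (f + g) (x m) (y m) - ∏ m ∈ s, f (x m) (y m)) +
        (Matrix.of fun x y : Fin k → V => g (x a) (y a)).hadamard
          (Matrix.of fun x y : Fin k → V => ∏ m ∈ s, (f + g) (x m) (y m)) := by
      ext x y
      simp only [Finset.prod_insert ha, Matrix.of_apply, Matrix.add_apply, Matrix.hadamard_apply,
        LinearMap.add_apply]
      ring
    rw [recursion]
    exact ((gram_posSemidef hf fun x : Fin k → V => x a).hadamard ih).add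
      ((gram_posSemidef hg fun x : Fin k → V => x a).hadamard (prod_gram_posSemidef (hf.add hg) s))

theorem powForm_le_add (hf : IsPosHermitian f) (hg : IsPosHermitian g) (k : ℕ) (X : ⨂[ℂ]^k V) :
    (powForm f k X X).re ≤ (powForm (f + g) k X X).re := by
  obtain ⟨c, rfl⟩ := exists_eq_sum_tprod X
  refine re_apply_self_le_of_posSemidef ?_ c
  simpa only [powForm_tprod hf, powForm_tprod (hf.add hg)] using
    prod_add_gram_sub_prod_gram_posSemidef hf hg Finset.univ

theorem powForm_smul (hf : IsPosHermitian f) {r : ℝ} (hr : 0 ≤ r) (k : ℕ) (X : ⨂[ℂ]^k V) :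
    (powForm ((r : ℂ) • f) k X X).re = r ^ k * (powForm f k X X).re := by
  obtain ⟨c, rfl⟩ := exists_eq_sum_tprod X
  have h : ∀ x y : Fin k → V,
      powForm ((r : ℂ) • f) k (PiTensorProduct.tprod ℂ x) (PiTensorProduct.tprod ℂ y) =
        ((r : ℂ) ^ k • powForm f k) (PiTensorProduct.tprod ℂ x) (PiTensorProduct.tprod ℂ y) := by
    intro x y
    simp [powForm_tprod hf, powForm_tprod (hf.smul hr), Finset.prod_mul_distrib]
  rw [sesq_finsuppSum]
  simp only [h]
  rw [← sesq_finsuppSum, ← Complex.ofReal_pow]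
  exact Complex.re_ofReal_mul _ _

theorem powForm_zero_eq (hf : IsPosHermitian f) (hg : IsPosHermitian g) (X : ⨂[ℂ]^0 V) :
    powForm f 0 X X = powForm g 0 X X := by
  obtain ⟨c, rfl⟩ := exists_eq_sum_tprod X
  rw [sesq_finsuppSum, sesq_finsuppSum]
  simp only [powForm_tprod hf, powForm_tprod hg, Finset.univ_eq_empty, Finset.prod_empty]

end TensorPowers

section Domination

variable {V : Type*} [AddCommGroup V] [Module ℂ V] {f g : V →ₗ⋆[ℂ] V →ₗ[ℂ] ℂ}
  {b : LinearMap.BilinForm ℂ V}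

/-- As a linear functional on `V ⊗ V`, the bilinear form `b` is bounded by one for the Hilbert
seminorm given by `f`. The value of the functional is encoded as a tensor of degree zero, so that
this is the first of the estimates `Dominated.powForm_contractFirst_le`. -/
def Dominated (f : V →ₗ⋆[ℂ] V →ₗ[ℂ] ℂ) (b : LinearMap.BilinForm ℂ V) : Prop :=
  ∀ X : ⨂[ℂ]^2 V, (powForm f 0 (contractFirst b 0 X) (contractFirst b 0 X)).re ≤
    (powForm f 2 X X).re

theorem Dominated.add (h : Dominated f b) (hf : IsPosHermitian f) (hg : IsPosHermitian g) :
    Dominated (f + g) b := fun X => by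
  rw [powForm_zero_eq (hf.add hg) hf]
  exact (h X).trans (powForm_le_add hf hg 2 X)

theorem powForm_contractFirst_tprod (hf : IsPosHermitian f) (b : LinearMap.BilinForm ℂ V) {k : ℕ}
    (x y : Fin (k + 2) → V) :
    powForm f k (contractFirst b k (PiTensorProduct.tprod ℂ x))
        (contractFirst b k (PiTensorProduct.tprod ℂ y)) =
      conj (b (x 0) (x 1)) * b (y 0) (y 1) * ∏ m : Fin k, f (x m.succ.succ) (y m.succ.succ) := by
  simp only [contractFirst_tprod, map_smulₛₗ, LinearMap.smul_apply, smul_eq_mul,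
    powForm_tprod hf, RingHom.id_apply]
  ring

theorem Dominated.norm_apply_le (h : Dominated f b) (hf : IsPosHermitian f) (v w : V) :
    ‖b v w‖ ≤ hf.seminorm v * hf.seminorm w := by
  refine (pow_le_pow_iff_left₀ (norm_nonneg _)
    (mul_nonneg (apply_nonneg _ _) (apply_nonneg _ _)) two_ne_zero).1 ?_
  have h' := h (PiTensorProduct.tprod ℂ ![v, w])
  rw [powForm_contractFirst_tprod hf, powForm_tprod hf] at h'
  simp only [Fin.prod_univ_two, Finset.univ_eq_empty, Finset.prod_empty, mul_one,
    Matrix.cons_val_zero, Matrix.cons_val_one, Complex.conj_mul'] at h'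
  rw [hf.apply_self v, hf.apply_self w] at h'
  rw [mul_pow, hf.seminorm_sq, hf.seminorm_sq]
  exact_mod_cast h'

open scoped ComplexOrder in
theorem Dominated.kernel_posSemidef (h : Dominated f b) (hf : IsPosHermitian f) :
    (Matrix.of fun p q : V × V =>
      f p.1 q.1 * f p.2 q.2 - conj (b p.1 p.2) * b q.1 q.2).PosSemidef := by
  refine ⟨?_, fun c => ?_⟩
  · ext p q
    simp [hf.conj_symm, mul_comm]
  have kernel_eq : ∀ p q : V × V, f p.1 q.1 * f p.2 q.2 - conj (b p.1 p.2) * b q.1 q.2 =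
      powForm f 2 (PiTensorProduct.tprod ℂ ![p.1, p.2]) (PiTensorProduct.tprod ℂ ![q.1, q.2]) -
        powForm f 0 (contractFirst b 0 (PiTensorProduct.tprod ℂ ![p.1, p.2]))
          (contractFirst b 0 (PiTensorProduct.tprod ℂ ![q.1, q.2])) := fun p q => by
    rw [powForm_contractFirst_tprod hf, powForm_tprod hf]
    simp
  let X : ⨂[ℂ]^2 V := c.sum fun p a => a • PiTensorProduct.tprod ℂ ![p.1, p.2]
  have map_X : contractFirst b 0 X =
      c.sum fun p a => a • contractFirst b 0 (PiTensorProduct.tprod ℂ ![p.1, p.2]) := by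
    simp only [X, map_finsuppSum, map_smul]
  simp only [Matrix.of_apply, kernel_eq, mul_sub, sub_mul, Finsupp.sum_sub]
  rw [← sesq_finsuppSum (powForm f 2), ← sesq_finsuppSum (powForm f 0), ← map_X,
    (powForm_isPosHermitian hf 2).apply_self, (powForm_isPosHermitian hf 0).apply_self]
  exact_mod_cast sub_nonneg.2 (h X)

open scoped ComplexOrder in
theorem Dominated.powForm_contractFirst_le (h : Dominated f b) (hf : IsPosHermitian f) (k : ℕ)
    (X : ⨂[ℂ]^(k + 2) V) :
    (powForm f k (contractFirst b k X) (contractFirst b k X)).re ≤ (powForm f (k + 2) X X).re := by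
  obtain ⟨c, rfl⟩ := exists_eq_sum_tprod X
  have map_sum : contractFirst b k (c.sum fun x a => a • PiTensorProduct.tprod ℂ x) =
      c.sum fun x a => a • contractFirst b k (PiTensorProduct.tprod ℂ x) := by
    simp only [map_finsuppSum, map_smul]
  rw [map_sum]
  refine re_apply_self_le_of_posSemidef (f := powForm f k) (g := powForm f (k + 2))
    (x := fun x => contractFirst b k (PiTensorProduct.tprod ℂ x))
    (y := fun x => PiTensorProduct.tprod ℂ x) ?_ c
  have kernel_eq : (Matrix.of fun x y : Fin (k + 2) → V =>
        powForm f (k + 2) (PiTensorProduct.tprod ℂ x) (PiTensorProduct.tprod ℂ y) -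
          powForm f k (contractFirst b k (PiTensorProduct.tprod ℂ x))
            (contractFirst b k (PiTensorProduct.tprod ℂ y))) =
      ((Matrix.of fun p q : V × V =>
        f p.1 q.1 * f p.2 q.2 - conj (b p.1 p.2) * b q.1 q.2).submatrix
          (fun x : Fin (k + 2) → V => (x 0, x 1)) fun x => (x 0, x 1)).hadamard
      ((Matrix.of fun x y : Fin k → V => ∏ m, f (x m) (y m)).submatrix
        (fun (x : Fin (k + 2) → V) i => x i.succ.succ) fun x i => x i.succ.succ) := by
    ext x y
    simp only [powForm_contractFirst_tprod hf, powForm_tprod hf, Matrix.hadamard_apply,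
      Matrix.submatrix_apply, Matrix.of_apply, Fin.prod_univ_succ, Fin.succ_zero_eq_one]
    ring
  rw [kernel_eq]
  exact ((h.kernel_posSemidef hf).submatrix _).hadamard
    ((prod_gram_posSemidef hf Finset.univ).submatrix _)

end Domination

section HilbertSchmidt

variable {V : Type*} [AddCommGroup V] [Module ℂ V] {f : V →ₗ⋆[ℂ] V →ₗ[ℂ] ℂ}
  {b : LinearMap.BilinForm ℂ V}

theorem powForm_two_orthonormal_sum (hf : IsPosHermitian f) {d : ℕ} {e : Fin d → V}
    (he : ∀ i j, f (e i) (e j) = if i = j then 1 else 0) (a : Fin d × Fin d → ℂ) :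
    (powForm f 2 (∑ p, a p • PiTensorProduct.tprod ℂ ![e p.1, e p.2])
      (∑ p, a p • PiTensorProduct.tprod ℂ ![e p.1, e p.2])).re = ∑ p, ‖a p‖ ^ 2 := by
  have orthonormal : ∀ p q : Fin d × Fin d, powForm f 2 (PiTensorProduct.tprod ℂ ![e p.1, e p.2])
      (PiTensorProduct.tprod ℂ ![e q.1, e q.2]) = if p = q then 1 else 0 := fun p q => by
    simp only [powForm_tprod hf, Fin.prod_univ_two, Matrix.cons_val_zero, Matrix.cons_val_one, he,
      ite_mul, one_mul, zero_mul, Prod.ext_iff, ite_and]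
  simp only [map_sum, LinearMap.sum_apply, map_smulₛₗ, LinearMap.smul_apply, orthonormal,
    RingHom.id_apply, smul_eq_mul, mul_ite, mul_one, mul_zero, Finset.sum_ite_eq',
    Finset.mem_univ, if_true, Complex.mul_conj', Complex.re_sum]
  exact_mod_cast rfl

theorem powForm_contractFirst_sum (hf : IsPosHermitian f) (b : LinearMap.BilinForm ℂ V)
    {ι : Type*} (s : Finset ι) (a : ι → ℂ) (x : ι → Fin 2 → V) :
    (powForm f 0 (contractFirst b 0 (∑ i ∈ s, a i • PiTensorProduct.tprod ℂ (x i)))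
      (contractFirst b 0 (∑ i ∈ s, a i • PiTensorProduct.tprod ℂ (x i)))).re =
    ‖∑ i ∈ s, a i * b (x i 0) (x i 1)‖ ^ 2 := by
  have scalar : contractFirst b 0 (∑ i ∈ s, a i • PiTensorProduct.tprod ℂ (x i)) =
      (∑ i ∈ s, a i * b (x i 0) (x i 1)) • PiTensorProduct.tprod ℂ Fin.elim0 := by
    simp only [map_sum, map_smul, contractFirst_tprod, Finset.sum_smul, mul_smul,
      Subsingleton.elim _ (Fin.elim0 : Fin 0 → V)]
  rw [scalar]
  simp only [map_smulₛₗ, LinearMap.smul_apply, powForm_tprod hf, Finset.univ_eq_empty,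
    Finset.prod_empty, RingHom.id_apply, smul_eq_mul, mul_one, Complex.mul_conj']
  exact_mod_cast rfl

theorem tprod_sub_mem_ker_inf_ker (hf : IsPosHermitian f)
    (h0 : ∀ v w, hf.seminorm v = 0 ∨ hf.seminorm w = 0 → b v w = 0) {v v' w w' : V}
    (hv : hf.seminorm (v - v') = 0) (hw : hf.seminorm (w - w') = 0) :
    PiTensorProduct.tprod ℂ ![v, w] - PiTensorProduct.tprod ℂ ![v', w'] ∈
      LinearMap.ker (powForm f 2) ⊓ LinearMap.ker (contractFirst b 0) := by
  have hfv : f v = f v' := sub_eq_zero.1 ((map_sub f v v').symm.trans (hf.apply_eq_zero hv))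
  have hfw : f w = f w' := sub_eq_zero.1 ((map_sub f w w').symm.trans (hf.apply_eq_zero hw))
  have hb : b v w = b v' w' := by
    have hv' := h0 (v - v') w (Or.inl hv)
    have hw' := h0 v' (w - w') (Or.inr hw)
    rw [map_sub, LinearMap.sub_apply, sub_eq_zero] at hv'
    rw [map_sub, sub_eq_zero] at hw'
    exact hv'.trans hw'
  refine ⟨LinearMap.mem_ker.2 ?_, LinearMap.mem_ker.2 ?_⟩
  · rw [map_sub, sub_eq_zero]
    ext y
    simp [powForm_tprod hf, hfv, hfw]
  · rw [map_sub, sub_eq_zero, contractFirst_tprod, contractFirst_tprod,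
      Subsingleton.elim (fun i : Fin 0 => ![v, w] i.succ.succ) fun i => ![v', w'] i.succ.succ]
    simp [hb]

theorem tprod_two_sum {d : ℕ} (a c : Fin d → ℂ) (e : Fin d → V) :
    PiTensorProduct.tprod ℂ ![∑ i, a i • e i, ∑ i, c i • e i] =
      ∑ p : Fin d × Fin d, (a p.1 * c p.2) • PiTensorProduct.tprod ℂ ![e p.1, e p.2] := by
  let T : MultilinearMap ℂ (fun _ : Fin 2 => V) (⨂[ℂ]^2 V) := PiTensorProduct.tprod ℂ
  have sum_left : ∀ w, T ![∑ i, a i • e i, w] = ∑ i, a i • T ![e i, w] := fun w => by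
    change T.curryLeft (∑ i, a i • e i) ![w] = ∑ i, a i • T.curryLeft (e i) ![w]
    simp only [map_sum, map_smul, sum_apply, smul_apply]
  have sum_right : ∀ v, T ![v, ∑ i, c i • e i] = ∑ i, c i • T ![v, e i] := fun v => by
    change (T.curryLeft v).curryLeft (∑ i, c i • e i) ![] =
      ∑ i, c i • (T.curryLeft v).curryLeft (e i) ![]
    simp only [map_sum, map_smul, sum_apply, smul_apply]
  change T _ = ∑ p : Fin d × Fin d, (a p.1 * c p.2) • T ![e p.1, e p.2]
  simp only [sum_left, sum_right, Finset.smul_sum, smul_smul, Fintype.sum_prod_type]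

theorem exists_orthonormal_sum_sub_mem_ker (hf : IsPosHermitian f)
    (h0 : ∀ v w, hf.seminorm v = 0 ∨ hf.seminorm w = 0 → b v w = 0) (X : ⨂[ℂ]^2 V) :
    ∃ (d : ℕ) (e : Fin d → V), (∀ i j, f (e i) (e j) = if i = j then 1 else 0) ∧
      ∃ a : Fin d × Fin d → ℂ, X - ∑ p, a p • PiTensorProduct.tprod ℂ ![e p.1, e p.2] ∈
        LinearMap.ker (powForm f 2) ⊓ LinearMap.ker (contractFirst b 0) := by
  classical
  obtain ⟨c, rfl⟩ := exists_eq_sum_tprod X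
  obtain ⟨d, e, he, hspan⟩ := hf.exists_orthonormal_span
    (c.support.image (fun x => x 0) ∪ c.support.image fun x => x 1)
  let proj : V → V := fun v => ∑ i, f (e i) v • e i
  refine ⟨d, e, he, fun p => ∑ x ∈ c.support, c x * (f (e p.1) (x 0) * f (e p.2) (x 1)), ?_⟩
  have collect : ∑ p : Fin d × Fin d,
        (∑ x ∈ c.support, c x * (f (e p.1) (x 0) * f (e p.2) (x 1))) •
          PiTensorProduct.tprod ℂ ![e p.1, e p.2] =
      ∑ x ∈ c.support, c x • PiTensorProduct.tprod ℂ ![proj (x 0), proj (x 1)] := by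
    simp only [proj, tprod_two_sum, Finset.sum_smul, Finset.smul_sum, smul_smul]
    exact Finset.sum_comm
  rw [collect, Finsupp.sum, ← Finset.sum_sub_distrib]
  refine Submodule.sum_mem _ fun x hx => ?_
  rw [← smul_sub, show x = ![x 0, x 1] from List.ofFn_inj.1 rfl]
  exact Submodule.smul_mem _ _ <| tprod_sub_mem_ker_inf_ker hf h0
    (hspan _ (Finset.mem_union_left _ (Finset.mem_image_of_mem _ hx)))
    (hspan _ (Finset.mem_union_right _ (Finset.mem_image_of_mem _ hx)))

theorem dominated_of_orthonormal (hf : IsPosHermitian f)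
    (h0 : ∀ v w, hf.seminorm v = 0 ∨ hf.seminorm w = 0 → b v w = 0)
    (h1 : ∀ (d : ℕ) (e : Fin d → V), (∀ i j, f (e i) (e j) = if i = j then 1 else 0) →
      ∑ i, ∑ j, ‖b (e i) (e j)‖ ^ 2 ≤ 1) : Dominated f b := fun X => by
  obtain ⟨d, e, he, a, hX⟩ := exists_orthonormal_sum_sub_mem_ker hf h0 X
  set Y := ∑ p, a p • PiTensorProduct.tprod ℂ ![e p.1, e p.2] with hY
  have form_eq : powForm f 2 X = powForm f 2 Y := sub_eq_zero.1 ((map_sub _ _ _).symm.trans hX.1)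
  have apply_eq : powForm f 2 X X = powForm f 2 Y Y := by
    rw [form_eq, ← (powForm_isPosHermitian hf 2).conj_symm, form_eq,
      (powForm_isPosHermitian hf 2).conj_symm]
  have contract_eq : contractFirst b 0 X = contractFirst b 0 Y :=
    sub_eq_zero.1 ((map_sub _ _ _).symm.trans hX.2)
  rw [apply_eq, contract_eq, hY, powForm_contractFirst_sum hf, powForm_two_orthonormal_sum hf he]
  calc ‖∑ p, a p * b (e p.1) (e p.2)‖ ^ 2 ≤ (∑ p, ‖a p‖ * ‖b (e p.1) (e p.2)‖) ^ 2 := by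
        gcongr
        exact (norm_sum_le _ _).trans_eq (Finset.sum_congr rfl fun p _ => norm_mul _ _)
    _ ≤ (∑ p, ‖a p‖ ^ 2) * ∑ p : Fin d × Fin d, ‖b (e p.1) (e p.2)‖ ^ 2 :=
        Finset.sum_mul_sq_le_sq_mul_sq _ _ _
    _ ≤ ∑ p, ‖a p‖ ^ 2 := by
        refine mul_le_of_le_one_right (Finset.sum_nonneg fun p _ => sq_nonneg _) ?_
        rw [Fintype.sum_prod_type]
        exact h1 d e he

-- Test the bound on the tensor `∑ conj (b (e i) (e j)) • e i ⊗ e j`.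
theorem Dominated.orthonormal_sum_le_one (h : Dominated f b) (hf : IsPosHermitian f) {d : ℕ}
    {e : Fin d → V} (he : ∀ i j, f (e i) (e j) = if i = j then 1 else 0) :
    ∑ i, ∑ j, ‖b (e i) (e j)‖ ^ 2 ≤ 1 := by
  rw [← Fintype.sum_prod_type']
  set s := ∑ p : Fin d × Fin d, ‖b (e p.1) (e p.2)‖ ^ 2 with hs
  have bound := h (∑ p : Fin d × Fin d, conj (b (e p.1) (e p.2)) •
    PiTensorProduct.tprod ℂ ![e p.1, e p.2])
  have pairing_eq : ∑ p : Fin d × Fin d, conj (b (e p.1) (e p.2)) *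
      b (![e p.1, e p.2] 0) (![e p.1, e p.2] 1) = (s : ℂ) := by
    simp [hs, Complex.conj_mul']
  rw [powForm_contractFirst_sum hf, powForm_two_orthonormal_sum hf he, pairing_eq] at bound
  simp only [RCLike.norm_conj, ← hs, Complex.norm_real, Real.norm_eq_abs, sq_abs] at bound
  nlinarith

theorem isHilbertSchmidt_iff_exists_dominated [TopologicalSpace V] :
    IsHilbertSchmidt b ↔ ∃ α : ContForm V, Dominated α.form b := by
  refine ⟨fun ⟨α, h0, h1⟩ => ⟨α, dominated_of_orthonormal α.isPosHermitian h0 h1⟩,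
    fun ⟨α, hα⟩ => ⟨α, fun v w hvw => ?_, fun d e he =>
      hα.orthonormal_sum_le_one α.isPosHermitian he⟩⟩
  have bound := hα.norm_apply_le α.isPosHermitian v w
  exact norm_le_zero_iff.1 (bound.trans_eq (mul_eq_zero.2 hvw))

theorem IsHilbertSchmidt.neg [TopologicalSpace V] (hb : IsHilbertSchmidt b) :
    IsHilbertSchmidt (-b) := by
  obtain ⟨α, h0, h1⟩ := hb
  exact ⟨α, fun v w h => by simp [h0 v w h], fun d e he => by simpa using h1 d e he⟩

end HilbertSchmidt

section Estimates

variable {V : Type*} [AddCommGroup V] [Module ℂ V] {f g : V →ₗ⋆[ℂ] V →ₗ[ℂ] ℂ}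

theorem exists_forall_ge_apply_eq_zero (X : Tens V) : ∃ n, ∀ k, n ≤ k → X k = 0 := by
  classical
  refine ⟨(DFinsupp.support X).sup id + 1, fun k hk => ?_⟩
  by_contra h
  exact absurd (Finset.le_sup (f := id) (DFinsupp.mem_support_iff.2 h)) (by simpa using hk)

theorem extForm_seminorm_sq (hf : IsPosHermitian f) (X : Tens V) {n : ℕ}
    (hn : ∀ k, n ≤ k → X k = 0) : (extForm_isPosHermitian hf).seminorm X ^ 2 =
      ∑ k ∈ Finset.range n, (k.factorial : ℝ) * (powForm f k (X k) (X k)).re := by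
  rw [IsPosHermitian.seminorm_sq, extForm_apply f X X (Finset.range n)
    fun k hk => hn k (by simpa using hk), Complex.re_sum]
  refine Finset.sum_congr rfl fun k _ => ?_
  rw [← Complex.ofReal_natCast, Complex.re_ofReal_mul]

theorem sum_shift_le_extForm_seminorm_sq (hf : IsPosHermitian f) (X : Tens V) (n j : ℕ) :
    ∑ k ∈ Finset.range n,
        ((k + j).factorial : ℝ) * (powForm f (k + j) (X (k + j)) (X (k + j))).re ≤
      (extForm_isPosHermitian hf).seminorm X ^ 2 := by
  obtain ⟨m, hm⟩ := exists_forall_ge_apply_eq_zero X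
  rw [extForm_seminorm_sq hf X (n := n + j + m) fun k hk => hm k (by omega), Finset.range_eq_Ico,
    Finset.sum_Ico_add' fun k => (k.factorial : ℝ) * (powForm f k (X k) (X k)).re]
  refine Finset.sum_le_sum_of_subset_of_nonneg (fun k hk => ?_) fun k _ _ =>
    mul_nonneg (Nat.cast_nonneg _) ((powForm_isPosHermitian hf k).nonneg _)
  rw [Finset.mem_Ico] at hk
  exact Finset.mem_range.2 (by omega)

theorem extForm_seminorm_incl_sq (hf : IsPosHermitian f) (k : ℕ) (x : ⨂[ℂ]^k V) :
    (extForm_isPosHermitian hf).seminorm (incl k x) ^ 2 =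
      (k.factorial : ℝ) * (powForm f k x x).re := by
  rw [IsPosHermitian.seminorm_sq, extForm_apply f _ _ {k} fun j hj => ?_]
  · rw [Finset.sum_singleton, DirectSum.lof_apply, ← Complex.ofReal_natCast, Complex.re_ofReal_mul]
  · exact DFinsupp.single_eq_of_ne (by simpa using hj)

theorem extForm_seminorm_le_add (hf : IsPosHermitian f) (hg : IsPosHermitian g) (X : Tens V) :
    (extForm_isPosHermitian hf).seminorm X ≤ (extForm_isPosHermitian (hf.add hg)).seminorm X := by
  obtain ⟨n, hn⟩ := exists_forall_ge_apply_eq_zero X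
  refine (pow_le_pow_iff_left₀ (apply_nonneg _ _) (apply_nonneg _ _) two_ne_zero).1 ?_
  rw [extForm_seminorm_sq hf _ hn, extForm_seminorm_sq (hf.add hg) _ hn]
  exact Finset.sum_le_sum fun k _ =>
    mul_le_mul_of_nonneg_left (powForm_le_add hf hg k _) (Nat.cast_nonneg _)

theorem laplace_incl (b : LinearMap.BilinForm ℂ V) (k : ℕ) (x : ⨂[ℂ]^k V) :
    laplace b (incl k x) = laplaceDeg b k x :=
  DirectSum.toModule_lof _ _ _

theorem laplace_apply (b : LinearMap.BilinForm ℂ V) (X : Tens V) (k : ℕ) :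
    laplace b X k = (((k + 2) * (k + 1) / 2 : ℝ) : ℂ) • contractFirst b k (X (k + 2)) := by
  have h : DirectSum.component ℂ ℕ (fun k => ⨂[ℂ]^k V) k ∘ₗ laplace b =
      (((k + 2) * (k + 1) / 2 : ℝ) : ℂ) • (contractFirst b k ∘ₗ
        DirectSum.component ℂ ℕ (fun k => ⨂[ℂ]^k V) (k + 2)) := by
    refine DirectSum.linearMap_ext (R := ℂ) fun j => LinearMap.ext fun x => ?_
    simp only [LinearMap.comp_apply, laplace_incl, LinearMap.smul_apply]
    match j with
    | 0 => simp [laplaceDeg, DirectSum.component.of]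
    | 1 => simp [laplaceDeg, DirectSum.component.of]
    | j + 2 =>
      obtain rfl | hj := eq_or_ne j k
      · simp [laplaceDeg]
      · simp [laplaceDeg, DirectSum.component.of, hj]
  exact LinearMap.congr_fun h X

theorem re_apply_ofReal_smul {E : Type*} [AddCommGroup E] [Module ℂ E]
    (f : E →ₗ⋆[ℂ] E →ₗ[ℂ] ℂ) (c : ℝ) (v : E) :
    (f ((c : ℂ) • v) ((c : ℂ) • v)).re = c ^ 2 * (f v v).re := by
  simp only [map_smulₛₗ, LinearMap.smul_apply, smul_eq_mul, Complex.conj_ofReal,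
    RingHom.id_apply, Complex.re_ofReal_mul]
  ring

theorem Dominated.powForm_laplace_pow_le {b : LinearMap.BilinForm ℂ V} (h : Dominated f b)
    (hf : IsPosHermitian f) (X : Tens V) (t k : ℕ) :
    (powForm f k ((laplace b ^ t) X k) ((laplace b ^ t) X k)).re ≤
      (((k + 2 * t).factorial : ℝ) / (k.factorial * 2 ^ t)) ^ 2 *
        (powForm f (k + 2 * t) (X (k + 2 * t)) (X (k + 2 * t))).re := by
  induction t generalizing k with
  | zero => simp [Nat.cast_ne_zero.2 k.factorial_ne_zero]
  | succ t ih =>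
    have coeff : ((k + 2) * (k + 1) / 2 : ℝ) *
          ((k + 2 + 2 * t).factorial / ((k + 2).factorial * 2 ^ t)) =
        (k + 2 + 2 * t).factorial / (k.factorial * 2 ^ (t + 1)) := by
      rw [Nat.factorial_succ (k + 1), Nat.factorial_succ k]
      have := Nat.cast_ne_zero (R := ℝ).2 k.factorial_ne_zero
      push_cast
      field_simp
      ring
    rw [pow_succ', Module.End.mul_apply, laplace_apply, re_apply_ofReal_smul,
      show k + 2 * (t + 1) = k + 2 + 2 * t by ring, ← coeff, mul_pow, mul_assoc]
    gcongr
    exact (h.powForm_contractFirst_le hf k _).trans (ih (k + 2))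

theorem factorial_add_two_mul_le (k t : ℕ) :
    (k + 2 * t).factorial ≤ 2 ^ (k + 2 * t) * k.factorial * (4 ^ t * t.factorial ^ 2) := by
  have central : (t + t).choose t ≤ 4 ^ t := by
    simpa [← two_mul, pow_mul] using Nat.choose_le_two_pow (t + t) t
  have factorial_two_mul : (2 * t).factorial ≤ 4 ^ t * t.factorial ^ 2 := by
    rw [two_mul, ← Nat.add_choose_mul_factorial_mul_factorial t t, mul_assoc, ← sq]
    gcongr
  rw [← Nat.add_choose_mul_factorial_mul_factorial k (2 * t)]
  gcongr
  exact Nat.choose_le_two_pow _ _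

theorem laplace_pow_coefficient_le {r : ℝ} (hr : 0 < r) (k t : ℕ) :
    k.factorial * (r ^ k * ((k + 2 * t).factorial / (k.factorial * 2 ^ t)) ^ 2) ≤
      (t.factorial * r⁻¹ ^ t) ^ 2 * ((k + 2 * t).factorial * (2 * r) ^ (k + 2 * t)) := by
  have bound : ((k + 2 * t).factorial : ℝ) ≤
      2 ^ (k + 2 * t) * k.factorial * (4 ^ t * t.factorial ^ 2) := by
    exact_mod_cast factorial_add_two_mul_le k t
  have four_pow : (2 ^ t : ℝ) ^ 2 = 4 ^ t := by
    rw [← pow_mul, mul_comm, pow_mul]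
    norm_num
  calc k.factorial * (r ^ k * ((k + 2 * t).factorial / (k.factorial * 2 ^ t)) ^ 2)
      = r ^ k * (k + 2 * t).factorial / (k.factorial * 4 ^ t) * (k + 2 * t).factorial := by
        rw [div_pow, mul_pow, four_pow]
        field_simp
    _ ≤ r ^ k * (k + 2 * t).factorial / (k.factorial * 4 ^ t) *
          (2 ^ (k + 2 * t) * k.factorial * (4 ^ t * t.factorial ^ 2)) := by gcongr
    _ = (t.factorial * r⁻¹ ^ t) ^ 2 * ((k + 2 * t).factorial * (2 * r) ^ (k + 2 * t)) := by
        rw [mul_pow, mul_pow 2 r, pow_add r, inv_pow, inv_pow, ← pow_mul, mul_comm t 2]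
        field_simp

theorem Dominated.seminorm_laplace_pow_le {b : LinearMap.BilinForm ℂ V} (h : Dominated f b)
    (hf : IsPosHermitian f) {r : ℝ} (hr : 0 < r) (X : Tens V) (t : ℕ) :
    (extForm_isPosHermitian (hf.smul hr.le)).seminorm ((laplace b ^ t) X) ≤
      t.factorial * r⁻¹ ^ t *
        (extForm_isPosHermitian (hf.smul (mul_pos two_pos hr).le)).seminorm X := by
  obtain ⟨n, hn⟩ := exists_forall_ge_apply_eq_zero ((laplace b ^ t) X)
  refine (pow_le_pow_iff_left₀ (apply_nonneg _ _) (by positivity) two_ne_zero).1 ?_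
  rw [mul_pow, extForm_seminorm_sq (hf.smul hr.le) _ hn]
  refine le_trans ?_ (mul_le_mul_of_nonneg_left
    (sum_shift_le_extForm_seminorm_sq (hf.smul (mul_pos two_pos hr).le) X n (2 * t)) (sq_nonneg _))
  rw [Finset.mul_sum]
  refine Finset.sum_le_sum fun k _ => ?_
  rw [powForm_smul hf hr.le, powForm_smul hf (mul_pos two_pos hr).le]
  calc _ ≤ k.factorial * (r ^ k * ((((k + 2 * t).factorial : ℝ) / (k.factorial * 2 ^ t)) ^ 2 *
        (powForm f (k + 2 * t) (X (k + 2 * t)) (X (k + 2 * t))).re)) := by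
        gcongr
        exact h.powForm_laplace_pow_le hf X t k
    _ ≤ _ := by
        simpa only [mul_assoc] using mul_le_mul_of_nonneg_right
          (laplace_pow_coefficient_le hr k t) ((powForm_isPosHermitian hf _).nonneg _)

end Estimates

section Continuity

variable {V : Type*} [AddCommGroup V] [Module ℂ V] [TopologicalSpace V]
  {b : LinearMap.BilinForm ℂ V}

theorem ContForm.continuous_seminorm_sub (α : ContForm V) (v : V) :
    Continuous fun w => hilbertSeminorms V α (w - v) := by
  refine Real.continuous_sqrt.comp (Complex.continuous_re.comp ?_)
  have joint := α.continuous_form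
  simp only [map_sub, LinearMap.sub_apply]
  exact ((joint.comp (continuous_id.prodMk continuous_id)).sub
    (joint.comp (continuous_const.prodMk continuous_id))).sub
    ((joint.comp (continuous_id.prodMk continuous_const)).sub continuous_const)

theorem ContForm.continuous_seminorm (α : ContForm V) : Continuous (hilbertSeminorms V α) := by
  simpa only [sub_zero] using α.continuous_seminorm_sub 0

theorem IsHilbertSchmidt.continuous_apply (hb : IsHilbertSchmidt b) :
    Continuous fun p : V × V => b p.1 p.2 := by
  obtain ⟨α, hα⟩ := isHilbertSchmidt_iff_exists_dominated.1 hb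
  have bound := hα.norm_apply_le α.isPosHermitian
  refine continuous_iff_continuousAt.2 fun p => ?_
  have dist_left := (α.continuous_seminorm_sub p.1).comp (continuous_fst (Y := V))
  have dist_right := (α.continuous_seminorm_sub p.2).comp (continuous_snd (X := V))
  have norm_right := α.continuous_seminorm.comp (continuous_snd (X := V))
  have majorant : Filter.Tendsto (fun q : V × V =>
      hilbertSeminorms V α (q.1 - p.1) * hilbertSeminorms V α q.2 +
        hilbertSeminorms V α p.1 * hilbertSeminorms V α (q.2 - p.2)) (nhds p) (nhds 0) := by
    simpa [Function.comp_def, Pi.mul_def, Pi.add_def] using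
      ((dist_left.mul norm_right).add (dist_right.const_mul _)).tendsto p
  rw [ContinuousAt, tendsto_iff_norm_sub_tendsto_zero]
  refine squeeze_zero (fun _ => norm_nonneg _) (fun q => ?_) majorant
  have split : b q.1 q.2 - b p.1 p.2 = b (q.1 - p.1) q.2 + b p.1 (q.2 - p.2) := by
    simp only [map_sub, LinearMap.sub_apply, sub_add_sub_cancel]
  rw [split]
  exact (norm_add_le _ _).trans (add_le_add (bound _ _) (bound _ _))

/-- The sum of two continuous positive Hermitian forms; it shows that the Hilbert seminorms are
directed. -/
def ContForm.add (α β : ContForm V) : ContForm V where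
  form := α.form + β.form
  isPosHermitian := α.isPosHermitian.add β.isPosHermitian
  continuous_form := α.continuous_form.add β.continuous_form

/-- A nonnegative real multiple of a continuous positive Hermitian form. Rescaling a form by `r`
multiplies its extension to tensors of degree `k` by `r ^ k`. -/
def ContForm.smul (r : ℝ) (hr : 0 ≤ r) (α : ContForm V) : ContForm V where
  form := (r : ℂ) • α.form
  isPosHermitian := α.isPosHermitian.smul hr
  continuous_form := continuous_const.mul α.continuous_form

theorem tensSeminorms_le_add_left (α β : ContForm V) :
    tensSeminorms V α ≤ tensSeminorms V (α.add β) :=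
  extForm_seminorm_le_add α.isPosHermitian β.isPosHermitian

theorem tensSeminorms_le_add_right (α β : ContForm V) :
    tensSeminorms V β ≤ tensSeminorms V (α.add β) := by
  have add_comm' : α.add β = β.add α := by
    simp only [ContForm.add, add_comm]
  rw [add_comm']
  exact tensSeminorms_le_add_left β α

theorem directed_tensSeminorms : Directed (· ≤ ·) (tensSeminorms V) := fun α β =>
  ⟨α.add β, tensSeminorms_le_add_left α β, tensSeminorms_le_add_right α β⟩

-- The form `α + r β` dominates `b`, and its multiple by `r⁻¹` is still larger than `β`.
theorem IsHilbertSchmidt.exists_laplace_pow_le (hb : IsHilbertSchmidt b) (β : ContForm V) {r : ℝ}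
    (hr : 0 < r) : ∃ γ : ContForm V, ∀ (t : ℕ) (X : Tens V),
      tensSeminorms V β ((laplace b ^ t) X) ≤ t.factorial * r ^ t * tensSeminorms V γ X := by
  obtain ⟨α, hα⟩ := isHilbertSchmidt_iff_exists_dominated.1 hb
  have hr' : 0 < r⁻¹ := inv_pos.2 hr
  let δ := α.add (β.smul r hr.le)
  have dominated : Dominated δ.form b :=
    hα.add α.isPosHermitian (β.smul r hr.le).isPosHermitian
  have rescale : δ.smul r⁻¹ hr'.le = (α.smul r⁻¹ hr'.le).add β := by
    have cancel : (r⁻¹ : ℂ) * r = 1 := inv_mul_cancel₀ (Complex.ofReal_ne_zero.2 hr.ne')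
    simp only [δ, ContForm.smul, ContForm.add, smul_add, smul_smul, Complex.ofReal_inv, cancel,
      one_smul]
  refine ⟨δ.smul (2 * r⁻¹) (mul_pos two_pos hr').le, fun t X => ?_⟩
  calc tensSeminorms V β ((laplace b ^ t) X)
      ≤ tensSeminorms V (δ.smul r⁻¹ hr'.le) ((laplace b ^ t) X) := by
        rw [rescale]
        exact tensSeminorms_le_add_right _ _ _
    _ ≤ t.factorial * r⁻¹⁻¹ ^ t * tensSeminorms V (δ.smul (2 * r⁻¹) _) X :=
        dominated.seminorm_laplace_pow_le δ.isPosHermitian hr' X t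
    _ = _ := by rw [inv_inv]

theorem LocallyNilpotent.exp_apply_eq_sum {E : Type*} [AddCommMonoid E] [Module ℂ E]
    {D : E →ₗ[ℂ] E} (hD : LocallyNilpotent D) {X : E} {N : ℕ} (hN : (D ^ N) X = 0) :
    hD.exp X = ∑ t ∈ Finset.range N, ((t.factorial : ℂ)⁻¹) • (D ^ t) X := by
  refine finsum_eq_sum_of_support_subset _ fun t ht => ?_
  by_contra h
  exact ht (by simp [pow_apply_eq_zero_of_le hN (by simpa using h)])

theorem seminorm_sum_le {𝕜 E κ : Type*} [SeminormedRing 𝕜] [AddCommGroup E] [Module 𝕜 E]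
    (q : Seminorm 𝕜 E) (s : Finset κ) (x : κ → E) : q (∑ k ∈ s, x k) ≤ ∑ k ∈ s, q (x k) :=
  Finset.le_sum_of_subadditive q (map_zero q).le (map_add_le_add q) s x

theorem continuous_of_le_tensSeminorms {T : Tens V →ₗ[ℂ] Tens V}
    (h : ∀ β, ∃ (C : NNReal) (γ : ContForm V), ∀ X,
      tensSeminorms V β (T X) ≤ C * tensSeminorms V γ X) : Continuous T := by
  refine WithSeminorms.continuous_of_isBounded withSeminorms_tens withSeminorms_tens T fun β => ?_
  obtain ⟨C, γ, h⟩ := h β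
  exact ⟨{γ}, C, fun X => by simpa [NNReal.smul_def] using h X⟩

theorem IsHilbertSchmidt.continuous_laplace (hb : IsHilbertSchmidt b) :
    Continuous (laplace b) := by
  refine continuous_of_le_tensSeminorms fun β => ?_
  obtain ⟨γ, hγ⟩ := hb.exists_laplace_pow_le β one_pos
  exact ⟨1, γ, fun X => by simpa using hγ 1 X⟩

theorem IsHilbertSchmidt.continuous_expLaplace (hb : IsHilbertSchmidt b) :
    Continuous (expLaplace b) := by
  refine continuous_of_le_tensSeminorms fun β => ?_
  obtain ⟨γ, hγ⟩ := hb.exists_laplace_pow_le β one_half_pos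
  refine ⟨2, γ, fun X => ?_⟩
  obtain ⟨N, hN⟩ := laplace_locallyNilpotent b X
  rw [expLaplace, LocallyNilpotent.exp_apply_eq_sum _ hN]
  calc _ ≤ ∑ t ∈ Finset.range N,
        tensSeminorms V β (((t.factorial : ℂ)⁻¹) • (laplace b ^ t) X) := seminorm_sum_le _ _ _
    _ ≤ ∑ t ∈ Finset.range N, (1 / 2 : ℝ) ^ t * tensSeminorms V γ X := by
        refine Finset.sum_le_sum fun t _ => ?_
        rw [map_smul_eq_mul, norm_inv, Complex.norm_natCast,
          inv_mul_le_iff₀ (Nat.cast_pos.2 t.factorial_pos), ← mul_assoc]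
        exact hγ t X
    _ = (∑ t ∈ Finset.range N, (1 / 2 : ℝ) ^ t) * tensSeminorms V γ X :=
        (Finset.sum_mul _ _ _).symm
    _ ≤ 2 * tensSeminorms V γ X :=
        mul_le_mul_of_nonneg_right (sum_geometric_two_le N) (apply_nonneg _ _)

theorem continuous_laplaceSym (h : Continuous (laplace b)) : Continuous (laplaceSym b) :=
  (h.comp continuous_subtype_val).subtype_mk _

theorem continuous_expLaplaceSym (h : Continuous (expLaplace b)) :
    Continuous (expLaplaceSym b) :=
  (h.comp continuous_subtype_val).subtype_mk _

/-- The seminorms defining the topology of the symmetric tensors: the restrictions of the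
seminorms of the tensor algebra. -/
def symSeminorms (V : Type*) [AddCommGroup V] [Module ℂ V] [TopologicalSpace V] :
    SeminormFamily ℂ (SymTens V) (ContForm V) :=
  (tensSeminorms V).comp (SymTens V).subtype

theorem withSeminorms_symTens : WithSeminorms (symSeminorms V) :=
  Topology.IsInducing.withSeminorms withSeminorms_tens Topology.IsInducing.subtypeVal

theorem exists_le_symSeminorms {q : Seminorm ℂ (SymTens V)} (hq : Continuous q) :
    ∃ C : NNReal, ∃ γ : ContForm V, ∀ X, q X ≤ C * symSeminorms V γ X := by
  obtain ⟨s, C, -, h⟩ := Seminorm.bound_of_continuous withSeminorms_symTens q hq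
  obtain ⟨γ, hγ⟩ := directed_tensSeminorms.finset_le s
  have sup_le : s.sup (symSeminorms V) ≤ symSeminorms V γ :=
    Finset.sup_le fun α hα => Seminorm.comp_mono _ (hγ α hα)
  exact ⟨C, γ, fun X => (h X).trans (mul_le_mul_of_nonneg_left (sup_le X) C.2)⟩

end Continuity

section Converse

variable {V : Type*} [AddCommGroup V] [Module ℂ V] {f : V →ₗ⋆[ℂ] V →ₗ[ℂ] ℂ}
  {b : LinearMap.BilinForm ℂ V}

theorem powForm_permute (hf : IsPosHermitian f) {k : ℕ} (σ : Equiv.Perm (Fin k))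
    (X : ⨂[ℂ]^k V) : powForm f k (permute σ X) (permute σ X) = powForm f k X X := by
  obtain ⟨c, rfl⟩ := exists_eq_sum_tprod X
  have permute_sum : permute σ (c.sum fun x a => a • PiTensorProduct.tprod ℂ x) =
      c.sum fun x a => a • PiTensorProduct.tprod ℂ fun i => x (σ i) := by
    simp only [map_finsuppSum, map_smul, permute_tprod]
  rw [permute_sum, sesq_finsuppSum, sesq_finsuppSum]
  simp only [powForm_tprod hf]
  refine Finset.sum_congr rfl fun x _ => Finset.sum_congr rfl fun y _ => ?_
  beta_reduce
  rw [Equiv.prod_comp σ fun m => f (x m) (y m)]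

theorem seminorm_symPow_le (hf : IsPosHermitian f) {k : ℕ} (X : ⨂[ℂ]^k V) :
    (powForm_isPosHermitian hf k).seminorm (symPow k X) ≤
      (powForm_isPosHermitian hf k).seminorm X := by
  rw [symPow, LinearMap.smul_apply, map_smul_eq_mul, norm_inv, Complex.norm_natCast,
    inv_mul_le_iff₀ (Nat.cast_pos.2 k.factorial_pos), LinearMap.sum_apply]
  refine (seminorm_sum_le _ _ _).trans_eq ?_
  simp [IsPosHermitian.seminorm_apply, powForm_permute hf, Fintype.card_perm]

theorem contractFirst_permute_two (hb : ∀ v w, b v w = b w v) (σ : Equiv.Perm (Fin 2))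
    (X : ⨂[ℂ]^2 V) : contractFirst b 0 (permute σ X) = contractFirst b 0 X := by
  suffices h : contractFirst b 0 ∘ₗ permute σ = contractFirst b 0 from LinearMap.congr_fun h X
  ext x
  have tail : (fun i : Fin 0 => x (σ i.succ.succ)) = fun i => x i.succ.succ :=
    Subsingleton.elim _ _
  simp only [LinearMap.compMultilinearMap_apply, LinearMap.comp_apply, permute_tprod,
    contractFirst_tprod, tail]
  obtain ⟨h0, h1⟩ | ⟨h0, h1⟩ := (by decide :
    ∀ σ : Equiv.Perm (Fin 2), σ 0 = 0 ∧ σ 1 = 1 ∨ σ 0 = 1 ∧ σ 1 = 0) σ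
  · rw [h0, h1]
  · rw [h0, h1, hb]

theorem contractFirst_symPow_two (hb : ∀ v w, b v w = b w v) (X : ⨂[ℂ]^2 V) :
    contractFirst b 0 (symPow 2 X) = contractFirst b 0 X := by
  simp only [symPow, LinearMap.smul_apply, LinearMap.sum_apply, map_smul, map_sum,
    contractFirst_permute_two hb]
  simp [Fintype.card_perm, ← Nat.cast_smul_eq_nsmul ℂ, smul_smul]

theorem expLaplace_incl_two_apply_zero (b : LinearMap.BilinForm ℂ V) (X : ⨂[ℂ]^2 V) :
    expLaplace b (incl 2 X) 0 = contractFirst b 0 X := by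
  have laplace_incl_two : laplace b (incl 2 X) = incl 0 (contractFirst b 0 X) := by
    rw [laplace_incl]
    simp [laplaceDeg]
  have laplace_sq : (laplace b ^ 2) (incl 2 X) = 0 := by
    rw [pow_two, Module.End.mul_apply, laplace_incl_two, laplace_incl]
    rfl
  rw [expLaplace, LocallyNilpotent.exp_apply_eq_sum _ laplace_sq, Finset.sum_range_succ,
    Finset.sum_range_one, pow_zero, pow_one, laplace_incl_two]
  have incl_two_zero : (incl 2 X : Tens V) 0 = 0 := DirectSum.of_eq_of_ne _ _ _ (by decide)
  have incl_zero : (incl 0 (contractFirst b 0 X) : Tens V) 0 = contractFirst b 0 X :=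
    DirectSum.of_eq_same _ _
  simp [DirectSum.add_apply, incl_two_zero, incl_zero]

-- Continuity of `e^{Δ_b}` on symmetric tensors of degree two, read off in degree zero, says
-- that `b` is a bounded functional on `V ⊗ V`.
theorem isHilbertSchmidt_of_continuous [TopologicalSpace V] (hb : ∀ v w, b v w = b w v)
    (h : Continuous (expLaplaceSym b)) : IsHilbertSchmidt b := by
  let δ : ContForm V := Classical.arbitrary _
  let q : Seminorm ℂ (SymTens V) := (symSeminorms V δ).comp (expLaplaceSym b)
  have continuous_q : Continuous q := by
    rw [Seminorm.coe_comp]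
    exact (withSeminorms_symTens.continuous_seminorm δ).comp h
  obtain ⟨C, γ, bound⟩ := exists_le_symSeminorms continuous_q
  have hr : (0 : ℝ) ≤ 2 * C := by positivity
  refine isHilbertSchmidt_iff_exists_dominated.2 ⟨γ.smul (2 * C) hr, fun X => ?_⟩
  have symPow_mem : incl 2 (symPow 2 X) ∈ SymTens V :=
    ⟨incl 2 X, by rw [symmetrizer, DirectSum.toModule_lof, LinearMap.comp_apply]⟩
  have symPow_le : (powForm γ.form 2 (symPow 2 X) (symPow 2 X)).re ≤ (powForm γ.form 2 X X).re := by
    simpa only [IsPosHermitian.seminorm_sq] using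
      pow_le_pow_left₀ (apply_nonneg _ _) (seminorm_symPow_le γ.isPosHermitian X) 2
  have nonneg := (powForm_isPosHermitian γ.isPosHermitian 2).nonneg X
  rw [powForm_zero_eq (γ.smul _ hr).isPosHermitian δ.isPosHermitian, ContForm.smul,
    powForm_smul γ.isPosHermitian hr]
  calc _ = ∑ k ∈ Finset.range 1, ((k + 0).factorial : ℝ) * (powForm δ.form (k + 0)
        (expLaplace b (incl 2 (symPow 2 X)) (k + 0))
        (expLaplace b (incl 2 (symPow 2 X)) (k + 0))).re := by
        simp [expLaplace_incl_two_apply_zero, contractFirst_symPow_two hb]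
    _ ≤ tensSeminorms V δ (expLaplace b (incl 2 (symPow 2 X))) ^ 2 :=
        sum_shift_le_extForm_seminorm_sq δ.isPosHermitian _ 1 0
    _ ≤ (C * tensSeminorms V γ (incl 2 (symPow 2 X))) ^ 2 :=
        pow_le_pow_left₀ (apply_nonneg _ _) (bound ⟨_, symPow_mem⟩) 2
    _ = C ^ 2 * (2 * (powForm γ.form 2 (symPow 2 X) (symPow 2 X)).re) := by
        rw [mul_pow, tensSeminorms, extForm_seminorm_incl_sq γ.isPosHermitian, Nat.factorial_two,
          Nat.cast_two]
    _ ≤ (2 * C) ^ 2 * (powForm γ.form 2 X X).re := by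
        nlinarith [mul_le_mul_of_nonneg_left symPow_le (sq_nonneg (C : ℝ)),
          mul_nonneg (sq_nonneg (C : ℝ)) nonneg]

end Converse

section Series

open Filter Topology

variable {𝕜 F ι : Type*} [NontriviallyNormedField 𝕜] [AddCommGroup F] [Module 𝕜 F]

theorem summable_seminorm_of_forall [TopologicalSpace F] {P : SeminormFamily 𝕜 F ι}
    (hP : WithSeminorms P) {κ : Type*} {f : κ → F} (h : ∀ i, Summable fun k => P i (f k))
    {q : Seminorm 𝕜 F} (hq : Continuous q) : Summable fun k => q (f k) := by
  obtain ⟨s, C, -, hC⟩ := Seminorm.bound_of_continuous hP q hq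
  refine Summable.of_nonneg_of_le (fun k => apply_nonneg q _) (fun k => ?_)
    ((summable_sum fun i (_ : i ∈ s) => h i).mul_left (C : ℝ))
  refine (hC (f k)).trans (mul_le_mul_of_nonneg_left ?_ C.2)
  exact (Seminorm.finset_sup_le_sum P s (f k)).trans_eq (sum_apply _ _ _)

theorem seminorm_smul_le (q : Seminorm 𝕜 F) {c : 𝕜} {s : ℝ} (hc : ‖c‖ ≤ s) (x : F) :
    q (c • x) ≤ s * q x := by
  rw [map_smul_eq_mul]
  gcongr

theorem seminorm_tsum_le [TopologicalSpace F] [T2Space F] {f : ℕ → F} {q : Seminorm 𝕜 F}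
    (hq : Continuous q) (hf : Summable f) {g : ℕ → ℝ} (hg : Summable g)
    (h : ∀ t, q (f t) ≤ g t) : q (∑' t, f t) ≤ ∑' t, g t :=
  le_of_tendsto_of_tendsto' ((hq.tendsto _).comp hf.hasSum.tendsto_sum_nat)
    hg.hasSum.tendsto_sum_nat fun _ =>
      (seminorm_sum_le q _ f).trans (Finset.sum_le_sum fun t _ => h t)

theorem exists_seminorm_lt_imp_mem [TopologicalSpace F] {P : SeminormFamily 𝕜 F ι}
    (hP : WithSeminorms P) {U : Set F} (hU : U ∈ 𝓝 (0 : F)) :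
    ∃ q : Seminorm 𝕜 F, Continuous q ∧ ∃ ε > 0, ∀ x, q x < ε → x ∈ U := by
  have := hP.topologicalAddGroup
  obtain ⟨s, ε, hε, h⟩ := (hP.mem_nhds_iff 0 U).1 hU
  exact ⟨s.sup P, Seminorm.continuous_finsetSup fun i _ => hP.continuous_seminorm i, ε, hε,
    fun x hx => h ((s.sup P).mem_ball_zero.2 hx)⟩

theorem summable_of_summable_seminorm [UniformSpace F] [IsUniformAddGroup F] [CompleteSpace F]
    {P : SeminormFamily 𝕜 F ι} (hP : WithSeminorms P) {κ : Type*} {f : κ → F}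
    (h : ∀ q : Seminorm 𝕜 F, Continuous q → Summable fun k => q (f k)) : Summable f := by
  rw [summable_iff_vanishing]
  intro U hU
  obtain ⟨q, hq, ε, hε, hqU⟩ := exists_seminorm_lt_imp_mem hP hU
  obtain ⟨s, hs⟩ := summable_iff_vanishing_norm.1 (h q hq) ε hε
  refine ⟨s, fun t ht => hqU _ ((seminorm_sum_le q t f).trans_lt ?_)⟩
  exact (le_abs_self _).trans_lt (hs t ht)

theorem hasDerivAt_of_seminorm_le [TopologicalSpace F] [ContinuousSMul 𝕜 F]
    {P : SeminormFamily 𝕜 F ι} (hP : WithSeminorms P) {f : 𝕜 → F} {D : F} {z : 𝕜}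
    (h : ∀ i, ∃ K : ℝ, ∀ᶠ w in 𝓝 z, P i (f w - f z - (w - z) • D) ≤ ‖w - z‖ ^ 2 * K) :
    HasDerivAt f D z := by
  have := hP.topologicalAddGroup
  refine ⟨?_⟩
  rw [Asymptotics.isLittleOTVS_iff_tendsto_inv_smul
    (Eventually.of_forall fun p hp => by simp [sub_eq_zero.1 hp]), hP.tendsto_nhds]
  intro i ε hε
  obtain ⟨K, hK⟩ := h i
  have small : ∀ᶠ w in 𝓝 z, ‖w - z‖ * K < ε := by
    have tendsto_zero : Tendsto (fun w => ‖w - z‖ * K) (𝓝 z) (𝓝 0) := by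
      have continuous_mul : Continuous fun w : 𝕜 => ‖w - z‖ * K := by fun_prop
      simpa using continuous_mul.tendsto z
    exact tendsto_zero.eventually_lt_const hε
  rw [prod_pure, eventually_map]
  filter_upwards [hK, small] with w hw hsmall
  rw [sub_zero, map_smul_eq_mul, norm_inv, ContinuousLinearMap.toSpanSingleton_apply]
  refine lt_of_le_of_lt ?_ hsmall
  calc _ ≤ ‖w - z‖⁻¹ * (‖w - z‖ ^ 2 * K) := by gcongr
    _ = ‖w - z‖ * K := by
        by_cases h0 : ‖w - z‖ = 0
        · simp [h0]
        · field_simp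

theorem natCast_mul_pow_pred_le {A : ℝ} (hA : 0 ≤ A) (t : ℕ) :
    t * A ^ (t - 1) ≤ (1 + A) ^ t := by
  cases t with
  | zero => simp
  | succ t =>
    rw [add_comm 1 A, add_pow]
    simpa [mul_comm] using Finset.single_le_sum
      (f := fun m => A ^ m * 1 ^ (t + 1 - m) * ((t + 1).choose m : ℝ))
      (fun m _ => by positivity) (Finset.mem_range.2 (by lia : t < t + 1 + 1))

theorem norm_natCast_mul_pow_pred_le (z : 𝕜) (t : ℕ) :
    ‖(t : 𝕜) * z ^ (t - 1)‖ ≤ (1 + ‖z‖) ^ t := by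
  have norm_cast_le : ‖(t : 𝕜)‖ ≤ t := by simpa using Nat.norm_cast_le (α := 𝕜) t
  rw [norm_mul, norm_pow]
  exact (mul_le_mul_of_nonneg_right norm_cast_le (by positivity)).trans
    (natCast_mul_pow_pred_le (norm_nonneg z) t)

theorem norm_add_pow_sub_le {z h : 𝕜} (hh : ‖h‖ ≤ 1) (t : ℕ) :
    ‖(z + h) ^ t - z ^ t - h * (t * z ^ (t - 1))‖ ≤ ‖h‖ ^ 2 * (2 + ‖z‖) ^ t := by
  induction t with
  | zero => simp
  | succ t ih =>
    have pow_pred : z * (t * z ^ (t - 1)) = t * z ^ t := by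
      cases t with
      | zero => simp
      | succ t => rw [Nat.add_sub_cancel]; ring
    have recurrence : (z + h) ^ (t + 1) - z ^ (t + 1) - h * ((t + 1 : ℕ) * z ^ (t + 1 - 1)) =
        (z + h) * ((z + h) ^ t - z ^ t - h * (t * z ^ (t - 1))) +
          h ^ 2 * (t * z ^ (t - 1)) := by
      rw [Nat.add_sub_cancel]
      push_cast
      linear_combination h * pow_pred
    have derivative_le : ‖(t : 𝕜) * z ^ (t - 1)‖ ≤ (2 + ‖z‖) ^ t :=
      (norm_natCast_mul_pow_pred_le z t).trans (by gcongr; norm_num)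
    have norm_add : ‖z + h‖ ≤ ‖z‖ + 1 := (norm_add_le _ _).trans (by gcongr)
    rw [recurrence]
    calc _ ≤ ‖z + h‖ * ‖(z + h) ^ t - z ^ t - h * (t * z ^ (t - 1))‖ +
          ‖h‖ ^ 2 * ‖(t : 𝕜) * z ^ (t - 1)‖ := by
          refine (norm_add_le _ _).trans_eq ?_
          rw [norm_mul, norm_mul (h ^ 2), norm_pow]
      _ ≤ (‖z‖ + 1) * (‖h‖ ^ 2 * (2 + ‖z‖) ^ t) + ‖h‖ ^ 2 * (2 + ‖z‖) ^ t := by gcongr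
      _ = _ := by ring

/-- The vectors `a t` are the coefficients of a power series `∑ zᵗ aₜ` which converges absolutely
for every `z`, with respect to every continuous seminorm. -/
def EntireSeries (𝕜 : Type*) {F : Type*} [NontriviallyNormedField 𝕜] [AddCommGroup F] [Module 𝕜 F]
    [TopologicalSpace F] (a : ℕ → F) : Prop :=
  ∀ q : Seminorm 𝕜 F, Continuous q → ∀ z : 𝕜, Summable fun t => q (z ^ t • a t)

namespace EntireSeries

variable {a : ℕ → F} {P : SeminormFamily 𝕜 F ι} {q : Seminorm 𝕜 F}

theorem summable_pow_mul [TopologicalSpace F] (ha : EntireSeries 𝕜 a) (hq : Continuous q) {R : ℝ}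
    (hR : 0 ≤ R) : Summable fun t => R ^ t * q (a t) := by
  obtain ⟨z, hz⟩ := NormedField.exists_lt_norm 𝕜 R
  refine Summable.of_nonneg_of_le (fun t => by positivity) (fun t => ?_) (ha q hq z)
  rw [map_smul_eq_mul, norm_pow]
  gcongr

variable [UniformSpace F] [IsUniformAddGroup F] [CompleteSpace F]

theorem summable_smul (hP : WithSeminorms P) (ha : EntireSeries 𝕜 a) {c : ℕ → 𝕜} {s R : ℝ}
    (hR : 0 ≤ R) (hc : ∀ t, ‖c t‖ ≤ s * R ^ t) : Summable fun t => c t • a t := by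
  refine summable_of_summable_seminorm hP fun q hq => ?_
  refine Summable.of_nonneg_of_le (fun t => apply_nonneg q _)
    (fun t => (seminorm_smul_le q (hc t) (a t)).trans_eq (mul_assoc _ _ _))
    ((ha.summable_pow_mul hq hR).mul_left s)

theorem summable (hP : WithSeminorms P) (ha : EntireSeries 𝕜 a) (z : 𝕜) :
    Summable fun t => z ^ t • a t :=
  summable_of_summable_seminorm hP fun q hq => ha q hq z

variable [T2Space F]

theorem seminorm_sum_sub_tsum_le (hP : WithSeminorms P) (ha : EntireSeries 𝕜 a)
    (hq : Continuous q) {z : 𝕜} {R : ℝ} (hz : ‖z‖ ≤ R) (N : ℕ) :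
    q (∑ t ∈ Finset.range N, z ^ t • a t - ∑' t, z ^ t • a t) ≤
      ∑' t, R ^ (t + N) * q (a (t + N)) := by
  have tail : ∑ t ∈ Finset.range N, z ^ t • a t - ∑' t, z ^ t • a t =
      -∑' t, z ^ (t + N) • a (t + N) := by
    rw [← (ha.summable hP z).sum_add_tsum_nat_add N, sub_add_cancel_left]
  rw [tail, map_neg_eq_map]
  refine seminorm_tsum_le hq ((summable_nat_add_iff N).2 (ha.summable hP z))
    ((summable_nat_add_iff N).2 (ha.summable_pow_mul hq ((norm_nonneg z).trans hz))) fun t => ?_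
  exact seminorm_smul_le q (by rw [norm_pow]; gcongr) _

theorem tendstoLocallyUniformly (hP : WithSeminorms P) (ha : EntireSeries 𝕜 a) :
    TendstoLocallyUniformly (fun (N : ℕ) (z : 𝕜) => ∑ t ∈ Finset.range N, z ^ t • a t)
      (fun z => ∑' t, z ^ t • a t) atTop := by
  intro u hu z
  rw [uniformity_eq_comap_nhds_zero, mem_comap] at hu
  obtain ⟨W, hW, hWu⟩ := hu
  obtain ⟨q, hq, ε, hε, hqW⟩ := exists_seminorm_lt_imp_mem hP hW
  refine ⟨Metric.ball z 1, Metric.ball_mem_nhds z one_pos, ?_⟩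
  filter_upwards [(tendsto_sum_nat_add fun t => (‖z‖ + 1) ^ t * q (a t)).eventually_lt_const hε]
    with N hN w hw
  have norm_le : ‖w‖ ≤ ‖z‖ + 1 := by
    have dist_lt := mem_ball_iff_norm.1 hw
    linarith [norm_le_norm_add_norm_sub' w z]
  exact hWu (hqW _ ((ha.seminorm_sum_sub_tsum_le hP hq norm_le N).trans_lt hN))

theorem seminorm_tsum_sub_le (hP : WithSeminorms P) (ha : EntireSeries 𝕜 a) (hq : Continuous q)
    {z w : 𝕜} (hw : ‖w - z‖ ≤ 1) :
    q (∑' t, w ^ t • a t - ∑' t, z ^ t • a t - (w - z) • ∑' t : ℕ, (t * z ^ (t - 1)) • a t) ≤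
      ‖w - z‖ ^ 2 * ∑' t, (2 + ‖z‖) ^ t * q (a t) := by
  have coefficient_le := norm_add_pow_sub_le (z := z) hw
  have summable_derivative : Summable fun t : ℕ => ((t : 𝕜) * z ^ (t - 1)) • a t :=
    ha.summable_smul hP (s := 1) (R := 1 + ‖z‖) (by positivity) fun t => by
      simpa using norm_natCast_mul_pow_pred_le z t
  have remainder : ∑' t, w ^ t • a t - ∑' t, z ^ t • a t -
      (w - z) • ∑' t : ℕ, ((t : 𝕜) * z ^ (t - 1)) • a t =
      ∑' t : ℕ, ((z + (w - z)) ^ t - z ^ t - (w - z) * (t * z ^ (t - 1))) • a t := by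
    have := hP.continuousSMul
    rw [← summable_derivative.tsum_const_smul, ← (ha.summable hP w).tsum_sub (ha.summable hP z),
      ← ((ha.summable hP w).sub (ha.summable hP z)).tsum_sub (summable_derivative.const_smul _)]
    refine tsum_congr fun t => ?_
    rw [add_sub_cancel, smul_smul, sub_smul (w ^ t - z ^ t), sub_smul (w ^ t)]
  rw [remainder, ← tsum_mul_left]
  refine seminorm_tsum_le hq (ha.summable_smul hP (by positivity) coefficient_le)
    ((ha.summable_pow_mul hq (by positivity)).mul_left _) fun t => ?_
  exact (seminorm_smul_le q (coefficient_le t) _).trans_eq (mul_assoc _ _ _)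

variable [ContinuousSMul 𝕜 F]

theorem hasDerivAt (hP : WithSeminorms P) (ha : EntireSeries 𝕜 a) (z : 𝕜) :
    HasDerivAt (fun z : 𝕜 => ∑' t, z ^ t • a t) (∑' t : ℕ, ((t : 𝕜) * z ^ (t - 1)) • a t) z := by
  refine hasDerivAt_of_seminorm_le hP fun i => ⟨∑' t, (2 + ‖z‖) ^ t * P i (a t), ?_⟩
  filter_upwards [Metric.ball_mem_nhds z one_pos] with w hw
  exact ha.seminorm_tsum_sub_le hP (hP.continuous_seminorm i) (mem_ball_iff_norm.1 hw).le

theorem differentiable (hP : WithSeminorms P) (ha : EntireSeries 𝕜 a) :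
    Differentiable 𝕜 fun z : 𝕜 => ∑' t, z ^ t • a t := fun z =>
  (ha.hasDerivAt hP z).hasFDerivAt.differentiableAt

end EntireSeries

end Series

section Completion

open UniformSpace Filter Topology

variable {𝕜 E ι : Type*} [NormedField 𝕜] [AddCommGroup E] [Module 𝕜 E] [UniformSpace E]
  [IsUniformAddGroup E] [UniformContinuousConstSMul 𝕜 E]

/-- The extension of a continuous seminorm to the completion. -/
def seminormCompletion (q : Seminorm 𝕜 E) (hq : Continuous q) : Seminorm 𝕜 (Completion E) :=
  have uniform := Seminorm.uniformContinuous_of_continuousAt_zero hq.continuousAt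
  Seminorm.of (Completion.extension q)
    (fun x y => by
      induction x, y using Completion.induction_on₂ with
      | hp =>
        exact isClosed_le (Completion.continuous_extension.comp continuous_add)
          ((Completion.continuous_extension.comp continuous_fst).add
            (Completion.continuous_extension.comp continuous_snd))
      | ih x y =>
        rw [← Completion.coe_add, Completion.extension_coe uniform,
          Completion.extension_coe uniform, Completion.extension_coe uniform]
        exact map_add_le_add q x y)
    (fun c x => by
      induction x using Completion.induction_on with
      | hp =>
        exact isClosed_eq (Completion.continuous_extension.comp (continuous_const_smul c))
          (continuous_const.mul Completion.continuous_extension)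
      | ih x =>
        rw [← Completion.coe_smul, Completion.extension_coe uniform,
          Completion.extension_coe uniform]
        exact map_smul_eq_mul q c x)

theorem seminormCompletion_coe (q : Seminorm 𝕜 E) (hq : Continuous q) (x : E) :
    seminormCompletion q hq x = q x :=
  Completion.extension_coe (Seminorm.uniformContinuous_of_continuousAt_zero hq.continuousAt) x

theorem continuous_seminormCompletion (q : Seminorm 𝕜 E) (hq : Continuous q) :
    Continuous (seminormCompletion q hq) :=
  Completion.continuous_extension

/-- The extensions of the seminorms defining the topology of a space to its completion. -/
def completionSeminorms {p : SeminormFamily 𝕜 E ι} (hp : WithSeminorms p) :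
    SeminormFamily 𝕜 (Completion E) ι := fun i =>
  seminormCompletion (p i) (hp.continuous_seminorm i)

theorem continuous_completionSeminorms {p : SeminormFamily 𝕜 E ι} (hp : WithSeminorms p) (i : ι) :
    Continuous (completionSeminorms hp i) :=
  continuous_seminormCompletion _ _

theorem completionSeminorms_coe {p : SeminormFamily 𝕜 E ι} (hp : WithSeminorms p) (i : ι) (x : E) :
    completionSeminorms hp i x = p i x :=
  seminormCompletion_coe _ _ x

theorem withSeminorms_completion {p : SeminormFamily 𝕜 E ι} (hp : WithSeminorms p) :
    WithSeminorms (completionSeminorms hp) := by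
  set P := completionSeminorms hp
  have continuous_sup (s : Finset ι) : Continuous (s.sup P : Seminorm 𝕜 (Completion E)) :=
    Seminorm.continuous_finsetSup (p := P) fun i _ => continuous_completionSeminorms hp i
  have sup_coe (s : Finset ι) (x : E) : s.sup P x = s.sup p x := by
    simp only [Seminorm.finset_sup_apply, P, completionSeminorms, seminormCompletion_coe]
  refine SeminormFamily.withSeminorms_of_hasBasis P ⟨fun U => ⟨fun hU => ?_, ?_⟩⟩
  · obtain ⟨W, hW, W_closed, W_subset⟩ := exists_mem_nhds_isClosed_subset hU
    have preimage_mem : ((↑) : E → Completion E) ⁻¹' W ∈ 𝓝 (0 : E) :=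
      (Completion.continuous_coe E).continuousAt.preimage_mem_nhds
        (by rwa [Completion.coe_zero])
    obtain ⟨s, r, hr, ball_subset⟩ := (hp.mem_nhds_iff 0 _).1 preimage_mem
    refine ⟨(s.sup P).ball 0 r, P.basisSets_mem s hr, fun x hx => W_subset ?_⟩
    have ball_open : IsOpen ((s.sup P).ball 0 r) := by
      rw [Seminorm.ball_zero_eq]
      exact isOpen_lt (continuous_sup s) continuous_const
    refine W_closed.closure_subset_iff.2 ?_
      (Completion.denseRange_coe.open_subset_closure_inter ball_open hx)
    rintro _ ⟨hy, y, rfl⟩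
    rw [Seminorm.mem_ball_zero, sup_coe] at hy
    exact ball_subset ((s.sup p).mem_ball_zero.2 hy)
  · rintro ⟨B, hB, hBU⟩
    obtain ⟨s, r, hr, rfl⟩ := P.basisSets_iff.1 hB
    exact mem_of_superset (Seminorm.ball_mem_nhds (continuous_sup s) hr) hBU

end Completion

section LaplaceCompletion

open UniformSpace Filter Topology

variable {V : Type*} [AddCommGroup V] [Module ℂ V] {b : LinearMap.BilinForm ℂ V}

theorem coe_laplaceSym_pow (b : LinearMap.BilinForm ℂ V) (t : ℕ) (X : SymTens V) :
    ((laplaceSym b ^ t) X : Tens V) = (laplace b ^ t) X := by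
  induction t with
  | zero => rfl
  | succ t ih =>
    rw [pow_succ', pow_succ', Module.End.mul_apply, Module.End.mul_apply, ← ih]
    rfl

variable [TopologicalSpace V]

/-- The extension of the Laplace operator `Δ_b` to the completion of the symmetric tensors. -/
def laplaceCpl (h : Continuous (laplaceSym b)) : SymCpl V →L[ℂ] SymCpl V :=
  ContinuousLinearMap.completion ⟨laplaceSym b, h⟩

theorem laplaceCpl_coe (h : Continuous (laplaceSym b)) (X : SymTens V) :
    laplaceCpl h X = (laplaceSym b X : SymTens V) :=
  ContinuousLinearMap.completion_apply_coe _ X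

theorem laplaceCpl_pow_coe (h : Continuous (laplaceSym b)) (t : ℕ) (X : SymTens V) :
    (laplaceCpl h ^ t) X = ((laplaceSym b ^ t) X : SymTens V) := by
  induction t with
  | zero => rfl
  | succ t ih => rw [pow_succ', pow_succ', mul_apply_eq_comp, ih, laplaceCpl_coe,
      Module.End.mul_apply]

theorem IsHilbertSchmidt.exists_laplaceCpl_pow_le (hb : IsHilbertSchmidt b)
    (h : Continuous (laplaceSym b)) (β : ContForm V) {r : ℝ} (hr : 0 < r) :
    ∃ γ : ContForm V, ∀ (t : ℕ) (X : SymCpl V),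
      completionSeminorms withSeminorms_symTens β ((laplaceCpl h ^ t) X) ≤
        t.factorial * r ^ t * completionSeminorms withSeminorms_symTens γ X := by
  obtain ⟨γ, hγ⟩ := hb.exists_laplace_pow_le β hr
  refine ⟨γ, fun t X => ?_⟩
  induction X using Completion.induction_on with
  | hp =>
    exact isClosed_le ((continuous_completionSeminorms _ _).comp (laplaceCpl h ^ t).continuous)
      (continuous_const.mul (continuous_completionSeminorms _ _))
  | ih X =>
    rw [laplaceCpl_pow_coe, completionSeminorms_coe, completionSeminorms_coe]
    have bound := hγ t X
    rwa [← coe_laplaceSym_pow] at bound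

theorem IsHilbertSchmidt.entireSeries (hb : IsHilbertSchmidt b) (h : Continuous (laplaceSym b))
    (X : SymCpl V) : EntireSeries ℂ fun t => (t.factorial : ℂ)⁻¹ • (laplaceCpl h ^ t) X := by
  intro q hq z
  refine summable_seminorm_of_forall (withSeminorms_completion withSeminorms_symTens)
    (fun β => ?_) hq
  have ratio_pos : 0 < (2 * (‖z‖ + 1))⁻¹ := by positivity
  obtain ⟨γ, hγ⟩ := hb.exists_laplaceCpl_pow_le h β ratio_pos
  refine Summable.of_nonneg_of_le (fun t => apply_nonneg _ _) (fun t => ?_)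
    (summable_geometric_two.mul_right (completionSeminorms withSeminorms_symTens γ X))
  have ratio_le : ‖z‖ * (2 * (‖z‖ + 1))⁻¹ ≤ 1 / 2 := by
    rw [← div_eq_mul_inv, div_le_div_iff₀ (by positivity) two_pos]
    linarith
  rw [map_smul_eq_mul, map_smul_eq_mul, norm_inv, norm_pow, Complex.norm_natCast]
  calc _ ≤ ‖z‖ ^ t * ((t.factorial : ℝ)⁻¹ * (t.factorial * (2 * (‖z‖ + 1))⁻¹ ^ t *
        completionSeminorms withSeminorms_symTens γ X)) := by
        gcongr
        exact hγ t X
    _ = (‖z‖ * (2 * (‖z‖ + 1))⁻¹) ^ t * completionSeminorms withSeminorms_symTens γ X := by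
        rw [mul_assoc, inv_mul_cancel_left₀ (Nat.cast_ne_zero.2 t.factorial_ne_zero), ← mul_assoc,
          mul_pow]
    _ ≤ _ := by gcongr

theorem IsHilbertSchmidt.exists_laplace_exp_series (hb : IsHilbertSchmidt b)
    (h : Continuous (laplaceSym b)) (X : SymCpl V) :
    ∃ F : ℂ → SymCpl V,
      (∀ q : Seminorm ℂ (SymCpl V), Continuous q →
        ∀ z : ℂ, Summable fun t : ℕ => q ((z ^ t / (t.factorial : ℂ)) • (laplaceCpl h ^ t) X)) ∧
      (∀ z : ℂ, HasSum (fun t : ℕ => (z ^ t / (t.factorial : ℂ)) • (laplaceCpl h ^ t) X) (F z)) ∧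
      TendstoLocallyUniformly
        (fun (N : ℕ) (z : ℂ) =>
          ∑ t ∈ Finset.range N, (z ^ t / (t.factorial : ℂ)) • (laplaceCpl h ^ t) X) F atTop ∧
      Differentiable ℂ F := by
  have entire := hb.entireSeries h X
  have hP := withSeminorms_completion (withSeminorms_symTens (V := V))
  have := hP.continuousSMul
  simp only [div_eq_mul_inv, mul_smul]
  exact ⟨_, entire, fun z => (entire.summable hP z).hasSum, entire.tendstoLocallyUniformly hP,
    entire.differentiable hP⟩

end LaplaceCompletion

section LocallyNilpotentExp

open Finset.HasAntidiagonal (antidiagonal mem_antidiagonal)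

variable {E F : Type*} [AddCommMonoid E] [Module ℂ E] [AddCommMonoid F] [Module ℂ F]

theorem pow_apply_of_comp_eq {D : Module.End ℂ E} {D' : Module.End ℂ F} {μ : E →ₗ[ℂ] F}
    (h : D' ∘ₗ μ = μ ∘ₗ D) (t : ℕ) (X : E) : (D' ^ t) (μ X) = μ ((D ^ t) X) :=
  LinearMap.congr_fun (Module.End.commute_pow_left_of_commute h t) X

theorem LocallyNilpotent.exp_apply_of_comp_eq {D : Module.End ℂ E} {D' : Module.End ℂ F}
    (hD' : LocallyNilpotent D') (hD : LocallyNilpotent D) {μ : E →ₗ[ℂ] F}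
    (h : D' ∘ₗ μ = μ ∘ₗ D) (X : E) : hD'.exp (μ X) = μ (hD.exp X) := by
  obtain ⟨N, hN⟩ := hD X
  have hN' : (D' ^ N) (μ X) = 0 := by rw [pow_apply_of_comp_eq h, hN, map_zero]
  simp only [hD.exp_apply_eq_sum hN, hD'.exp_apply_eq_sum hN', map_sum, map_smul,
    pow_apply_of_comp_eq h]

theorem LocallyNilpotent.restrict {D : Module.End ℂ E} (hD : LocallyNilpotent D)
    {S : Submodule ℂ E} (hS : ∀ X ∈ S, D X ∈ S) : LocallyNilpotent (D.restrict hS) := fun X => by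
  obtain ⟨N, hN⟩ := hD X
  exact ⟨N, Subtype.ext ((pow_apply_of_comp_eq (μ := S.subtype) rfl N X).symm.trans hN)⟩

theorem LocallyNilpotent.coe_exp_restrict {D : Module.End ℂ E} (hD : LocallyNilpotent D)
    {S : Submodule ℂ E} (hS : ∀ X ∈ S, D X ∈ S) (X : S) :
    ((hD.restrict hS).exp X : E) = hD.exp X :=
  (hD.exp_apply_of_comp_eq (hD.restrict hS) (μ := S.subtype) rfl X).symm

theorem LocallyNilpotent.rTensor {D : Module.End ℂ E} (hD : LocallyNilpotent D) :
    LocallyNilpotent (D.rTensor F) := fun Z => by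
  induction Z using TensorProduct.induction_on with
  | zero => exact ⟨0, map_zero _⟩
  | add X Y hX hY => exact exists_pow_add hX hY
  | tmul X Y =>
    obtain ⟨N, hN⟩ := hD X
    refine ⟨N, (pow_apply_of_comp_eq (μ := (TensorProduct.mk ℂ E F).flip Y) rfl N X).trans ?_⟩
    rw [hN, map_zero]

theorem LocallyNilpotent.lTensor {D : Module.End ℂ E} (hD : LocallyNilpotent D) :
    LocallyNilpotent (D.lTensor F) := fun Z => by
  induction Z using TensorProduct.induction_on with
  | zero => exact ⟨0, map_zero _⟩
  | add X Y hX hY => exact exists_pow_add hX hY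
  | tmul X Y =>
    obtain ⟨N, hN⟩ := hD Y
    refine ⟨N, (pow_apply_of_comp_eq (μ := TensorProduct.mk ℂ F E X) rfl N Y).trans ?_⟩
    rw [hN, map_zero]

theorem LocallyNilpotent.exp_rTensor_tmul {D : Module.End ℂ E} (hD : LocallyNilpotent D)
    (X : E) (Y : F) : (hD.rTensor (F := F)).exp (X ⊗ₜ Y) = hD.exp X ⊗ₜ Y :=
  hD.rTensor.exp_apply_of_comp_eq hD (μ := (TensorProduct.mk ℂ E F).flip Y) rfl X

theorem LocallyNilpotent.exp_lTensor_tmul {D : Module.End ℂ E} (hD : LocallyNilpotent D)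
    (Y : F) (X : E) : (hD.lTensor (F := F)).exp (Y ⊗ₜ X) = Y ⊗ₜ hD.exp X :=
  hD.lTensor.exp_apply_of_comp_eq hD (μ := TensorProduct.mk ℂ F E Y) rfl X

theorem LocallyNilpotent.exp_comm {A B : Module.End ℂ E} (hA : LocallyNilpotent A)
    (hB : LocallyNilpotent B) (hAB : Commute A B) (X : E) :
    hA.exp (hB.exp X) = hB.exp (hA.exp X) := by
  have hBA : hB.exp ∘ₗ A = A ∘ₗ hB.exp :=
    LinearMap.ext fun Y => hB.exp_apply_of_comp_eq hB (μ := A) hAB.eq.symm Y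
  exact hA.exp_apply_of_comp_eq hA hBA.symm X

variable {A B : Module.End ℂ E} {X : E} {N : ℕ}

theorem pow_mul_pow_apply_eq_zero (hAB : Commute A B) (hA : (A ^ N) X = 0) (hB : (B ^ N) X = 0)
    {i j : ℕ} (hij : N ≤ i ∨ N ≤ j) : (A ^ i * B ^ j) X = 0 := by
  rcases hij with hi | hj
  · rw [(hAB.pow_pow i j).eq, Module.End.mul_apply, pow_apply_eq_zero_of_le hA hi, map_zero]
  · rw [Module.End.mul_apply, pow_apply_eq_zero_of_le hB hj, map_zero]

theorem exists_pow_apply_eq_zero (hA : LocallyNilpotent A) (hB : LocallyNilpotent B) (X : E) :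
    ∃ N, (A ^ N) X = 0 ∧ (B ^ N) X = 0 := by
  obtain ⟨N, hN⟩ := hA X
  obtain ⟨M, hM⟩ := hB X
  exact ⟨max N M, pow_apply_eq_zero_of_le hN (le_max_left _ _),
    pow_apply_eq_zero_of_le hM (le_max_right _ _)⟩

theorem add_pow_apply_eq_zero (hAB : Commute A B) (hA : (A ^ N) X = 0) (hB : (B ^ N) X = 0) :
    ((A + B) ^ (2 * N)) X = 0 := by
  rw [hAB.add_pow', LinearMap.sum_apply]
  refine Finset.sum_eq_zero fun p hp => ?_
  rw [mem_antidiagonal] at hp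
  rw [LinearMap.smul_apply, pow_mul_pow_apply_eq_zero hAB hA hB (by omega), smul_zero]

theorem LocallyNilpotent.add (hA : LocallyNilpotent A) (hB : LocallyNilpotent B)
    (hAB : Commute A B) : LocallyNilpotent (A + B) := fun X => by
  obtain ⟨N, hN, hM⟩ := exists_pow_apply_eq_zero hA hB X
  exact ⟨2 * N, add_pow_apply_eq_zero hAB hN hM⟩

theorem sum_range_antidiagonal_eq_sum_product {M : Type*} [AddCommMonoid M] {f : ℕ × ℕ → M}
    (hf : ∀ p, N ≤ p.1 ∨ N ≤ p.2 → f p = 0) :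
    ∑ n ∈ Finset.range (2 * N), ∑ p ∈ antidiagonal n, f p =
      ∑ p ∈ Finset.range N ×ˢ Finset.range N, f p := by
  have hmaps : ∀ p ∈ Finset.range N ×ˢ Finset.range N, p.1 + p.2 ∈ Finset.range (2 * N) := by
    intro p hp
    simp only [Finset.mem_product, Finset.mem_range] at hp ⊢
    omega
  rw [← Finset.sum_fiberwise_of_maps_to hmaps]
  refine Finset.sum_congr rfl fun n _ => (Finset.sum_subset ?_ fun p hp hp' => hf p ?_).symm
  · exact fun p hp => mem_antidiagonal.2 (Finset.mem_filter.1 hp).2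
  · simp only [mem_antidiagonal, Finset.mem_filter, Finset.mem_product,
      Finset.mem_range] at hp hp'
    omega

theorem inv_factorial_add_mul_choose {K : Type*} [Field K] [CharZero K] (i j : ℕ) :
    ((i + j).factorial : K)⁻¹ * (i + j).choose i = (i.factorial : K)⁻¹ * (j.factorial : K)⁻¹ := by
  rw [Nat.cast_add_choose, div_eq_mul_inv,
    inv_mul_cancel_left₀ (Nat.cast_ne_zero.2 (i + j).factorial_ne_zero), mul_inv]

theorem inv_factorial_smul_add_pow (hAB : Commute A B) (n : ℕ) :
    (n.factorial : ℂ)⁻¹ • (A + B) ^ n = ∑ p ∈ antidiagonal n,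
      ((p.1.factorial : ℂ)⁻¹ * (p.2.factorial : ℂ)⁻¹) • (A ^ p.1 * B ^ p.2) := by
  rw [hAB.add_pow', Finset.smul_sum]
  refine Finset.sum_congr rfl fun p hp => ?_
  obtain rfl := mem_antidiagonal.1 hp
  rw [← Nat.cast_smul_eq_nsmul ℂ, smul_smul, inv_factorial_add_mul_choose]

theorem LocallyNilpotent.exp_add (hA : LocallyNilpotent A) (hB : LocallyNilpotent B)
    (hAB : Commute A B) (X : E) : (hA.add hB hAB).exp X = hA.exp (hB.exp X) := by
  obtain ⟨N, hAN, hBN⟩ := exists_pow_apply_eq_zero hA hB X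
  let f : ℕ × ℕ → E := fun p =>
    ((p.1.factorial : ℂ)⁻¹ * (p.2.factorial : ℂ)⁻¹) • (A ^ p.1 * B ^ p.2) X
  have hf : ∀ p, N ≤ p.1 ∨ N ≤ p.2 → f p = 0 := fun p hp => by
    simp only [f, pow_mul_pow_apply_eq_zero hAB hAN hBN hp, smul_zero]
  have hAB_exp : (hA.add hB hAB).exp X =
      ∑ n ∈ Finset.range (2 * N), ∑ p ∈ antidiagonal n, f p := by
    rw [LocallyNilpotent.exp_apply_eq_sum _ (add_pow_apply_eq_zero hAB hAN hBN)]
    simp only [← LinearMap.smul_apply, inv_factorial_smul_add_pow hAB,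
      LinearMap.sum_apply, f]
  have hA_exp : ∀ j, hA.exp ((B ^ j) X) =
      ∑ i ∈ Finset.range N, (i.factorial : ℂ)⁻¹ • (A ^ i * B ^ j) X := fun j =>
    hA.exp_apply_eq_sum (pow_mul_pow_apply_eq_zero hAB hAN hBN (Or.inl le_rfl))
  rw [hAB_exp, sum_range_antidiagonal_eq_sum_product hf, Finset.sum_product_right,
    hB.exp_apply_eq_sum hBN]
  simp only [f, map_sum, map_smul, hA_exp, Finset.smul_sum, smul_smul, mul_comm]

theorem LocallyNilpotent.exp_exp_neg {E : Type*} [AddCommGroup E] [Module ℂ E]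
    {A : Module.End ℂ E} (hA : LocallyNilpotent A) (hA' : LocallyNilpotent (-A)) (X : E) :
    hA.exp (hA'.exp X) = X := by
  have hpow : ((A + -A) ^ 1) X = 0 := by rw [add_neg_cancel, pow_one, LinearMap.zero_apply]
  rw [← hA.exp_add hA' (Commute.refl A).neg_right, LocallyNilpotent.exp_apply_eq_sum _ hpow]
  simp

end LocallyNilpotentExp

section Polarization

theorem sum_neg_one_pow_card_compl_of_subset {ι : Type*} [Fintype ι] [DecidableEq ι]
    (S : Finset ι) :
    ∑ T : Finset ι, (if S ⊆ T then (-1 : ℤ) ^ Tᶜ.card else 0) =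
      if S = Finset.univ then 1 else 0 := by
  calc _ = ∑ U : Finset ι, if U ⊆ Sᶜ then (-1 : ℤ) ^ U.card else 0 :=
        Fintype.sum_bijective compl compl_involutive.bijective _ _ fun T => by
          simp only [Finset.compl_subset_compl]
    _ = ∑ U ∈ Sᶜ.powerset, (-1 : ℤ) ^ U.card := by
        rw [← Finset.sum_filter]
        exact Finset.sum_congr (by ext; simp) fun _ _ => rfl
    _ = _ := by simp only [Finset.sum_powerset_neg_one_pow_card, Finset.compl_eq_empty_iff]

theorem sum_neg_one_pow_smul_map_sum_eq_sum_perm {R ι E M : Type*} [Semiring R] [Fintype ι]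
    [DecidableEq ι] [AddCommMonoid E] [Module R E] [AddCommGroup M] [Module R M]
    (f : MultilinearMap R (fun _ : ι => E) M) (x : ι → E) :
    ∑ T : Finset ι, (-1 : ℤ) ^ Tᶜ.card • f (fun _ => ∑ i ∈ T, x i) =
      ∑ σ : Equiv.Perm ι, f fun i => x (σ i) := by
  have hexpand : ∀ T : Finset ι, f (fun _ => ∑ i ∈ T, x i) =
      ∑ r : ι → ι, if Finset.univ.image r ⊆ T then f fun i => x (r i) else 0 := by
    intro T
    rw [f.map_sum_finset (fun _ i => x i) fun _ => T, ← Finset.sum_filter]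
    exact Finset.sum_congr (by ext r; simp [Finset.image_subset_iff]) fun _ _ => rfl
  calc _ = ∑ r : ι → ι, (∑ T : Finset ι,
          if Finset.univ.image r ⊆ T then (-1 : ℤ) ^ Tᶜ.card else 0) • f fun i => x (r i) := by
        simp only [hexpand, Finset.smul_sum, Finset.sum_smul, smul_ite, ite_smul, smul_zero,
          zero_smul]
        exact Finset.sum_comm
    _ = ∑ r : ι → ι, if Function.Bijective r then f (fun i => x (r i)) else 0 := by
        simp only [sum_neg_one_pow_card_compl_of_subset, ite_smul, one_smul, zero_smul,
          Finset.eq_univ_iff_forall, Finset.mem_image, Finset.mem_univ, true_and,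
          ← Finite.surjective_iff_bijective, Function.Surjective]
    _ = ∑ r : {r : ι → ι // Function.Bijective r}, f fun i => x (r.1 i) := by
        rw [← Finset.sum_filter, Finset.sum_subtype _ fun r => Finset.mem_filter_univ r]
    _ = _ := Fintype.sum_equiv Equiv.bijectiveEquiv _ _ fun _ => rfl

theorem eq_of_forall_sum_pow_smul_eq {𝕜 M : Type*} [Field 𝕜] [Infinite 𝕜] [AddCommGroup M]
    [Module 𝕜 M] {n : ℕ} {a a' : ℕ → M}
    (h : ∀ s : 𝕜, ∑ k ∈ Finset.range n, s ^ k • a k = ∑ k ∈ Finset.range n, s ^ k • a' k)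
    {k : ℕ} (hk : k < n) : a k = a' k := by
  refine sub_eq_zero.1 ((Module.forall_dual_apply_eq_zero_iff 𝕜 _).1 fun φ => ?_)
  let p (a : ℕ → M) : Polynomial 𝕜 := ∑ k ∈ Finset.range n, Polynomial.monomial k (φ (a k))
  have heval : ∀ a s, (p a).eval s = φ (∑ k ∈ Finset.range n, s ^ k • a k) := fun a s => by
    simp only [p, Polynomial.eval_finsetSum, Polynomial.eval_monomial, map_sum, map_smul,
      smul_eq_mul, mul_comm]
  have hcoeff : ∀ a, (p a).coeff k = φ (a k) := fun a => by
    simp [p, Polynomial.finsetSum_coeff, Polynomial.coeff_monomial, hk]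
  have hp : p a = p a' := Polynomial.funext fun s => by rw [heval, heval, h]
  rw [map_sub, sub_eq_zero, ← hcoeff, ← hcoeff, hp]

end Polarization

section DividedPowers

variable {V : Type*} [AddCommGroup V] [Module ℂ V]

/-- The divided power `v^{⊗n} / n!` in the tensor algebra. Negative `n` are allowed, with value
zero, so that `laplace_divPow` and `poisson_divPow` hold without case distinctions. -/
def divPow : ℤ → V → Tens V
  | Int.ofNat n, v => (n.factorial : ℂ)⁻¹ • incl n (PiTensorProduct.tprod ℂ fun _ => v)
  | Int.negSucc _, _ => 0

theorem divPow_natCast (n : ℕ) (v : V) :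
    divPow n v = (n.factorial : ℂ)⁻¹ • incl n (PiTensorProduct.tprod ℂ fun _ => v) := rfl

theorem divPow_of_neg {n : ℤ} (hn : n < 0) (v : V) : divPow n v = 0 := by
  obtain ⟨m, rfl⟩ := Int.eq_negSucc_of_lt_zero hn
  rfl

theorem incl_tprod_const (n : ℕ) (v : V) :
    incl n (PiTensorProduct.tprod ℂ fun _ => v) = (n.factorial : ℂ) • divPow n v := by
  rw [divPow_natCast, smul_inv_smul₀ (Nat.cast_ne_zero.2 n.factorial_ne_zero)]

theorem divPow_smul (n : ℕ) (s : ℂ) (v : V) : divPow n (s • v) = s ^ n • divPow n v := by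
  rw [divPow_natCast, divPow_natCast, MultilinearMap.map_smul_univ, Fin.prod_const, map_smul,
    smul_comm]

theorem symPow_tprod_const (n : ℕ) (v : V) :
    symPow n (PiTensorProduct.tprod ℂ fun _ : Fin n => v) = PiTensorProduct.tprod ℂ fun _ => v :=
  symPow_eq_self fun τ => permute_tprod τ _

theorem symPow_tprod_mem_span (k : ℕ) (x : Fin k → V) :
    symPow k (PiTensorProduct.tprod ℂ x) ∈
      Submodule.span ℂ (Set.range fun v : V => PiTensorProduct.tprod ℂ fun _ : Fin k => v) := by
  simp only [symPow, LinearMap.smul_apply, LinearMap.sum_apply, permute_tprod]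
  rw [← sum_neg_one_pow_smul_map_sum_eq_sum_perm]
  exact Submodule.smul_mem _ _ <| Submodule.sum_mem _ fun T _ =>
    zsmul_mem (Submodule.subset_span (Set.mem_range_self _)) _

theorem range_symPow_le_span (k : ℕ) :
    LinearMap.range (symPow k) ≤
      Submodule.span ℂ (Set.range fun v : V => PiTensorProduct.tprod ℂ fun _ : Fin k => v) := by
  rw [LinearMap.range_eq_map, ← PiTensorProduct.span_tprod_eq_top, Submodule.map_span_le]
  rintro _ ⟨x, rfl⟩
  exact symPow_tprod_mem_span k x

theorem symmetrizer_incl (n : ℕ) (x : ⨂[ℂ]^n V) :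
    symmetrizer V (incl n x) = incl n (symPow n x) :=
  DirectSum.toModule_lof _ _ _

theorem symTens_le_span_divPow :
    SymTens V ≤ Submodule.span ℂ (Set.range fun p : ℤ × V => divPow p.1 p.2) := by
  rintro _ ⟨X, rfl⟩
  induction X using DirectSum.induction_on with
  | zero => simp only [map_zero, Submodule.zero_mem]
  | add X Y hX hY => simpa only [map_add] using Submodule.add_mem _ hX hY
  | of k x =>
    rw [← DirectSum.lof_eq_of ℂ, symmetrizer_incl]
    refine (Submodule.map_span_le (incl k) _ _).2 ?_
      (Submodule.mem_map_of_mem (range_symPow_le_span k ⟨x, rfl⟩))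
    rintro _ ⟨v, rfl⟩
    rw [incl_tprod_const]
    exact Submodule.smul_mem _ _ (Submodule.subset_span ⟨(k, v), rfl⟩)

theorem laplace_divPow (b : LinearMap.BilinForm ℂ V) (n : ℤ) (v : V) :
    laplace b (divPow n v) = (b v v / 2) • divPow (n - 2) v := by
  rcases lt_or_ge n 0 with hn | hn
  · rw [divPow_of_neg hn, divPow_of_neg (by lia), map_zero, smul_zero]
  lift n to ℕ using hn
  rw [divPow_natCast, map_smul, laplace_incl]
  match n with
  | 0 | 1 => rw [divPow_of_neg (by lia), smul_zero, laplaceDeg, LinearMap.zero_apply, smul_zero]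
  | n + 2 =>
    have hn : ((n + 2 : ℕ) : ℤ) - 2 = n := by lia
    simp only [hn, divPow_natCast, laplaceDeg, LinearMap.smul_apply, LinearMap.comp_apply,
      contractFirst_tprod, map_smul, smul_smul, Nat.factorial_succ, Nat.cast_mul]
    have h₀ := Nat.cast_ne_zero (R := ℂ).2 n.factorial_ne_zero
    have h₁ := Nat.cast_ne_zero (R := ℂ).2 n.succ_ne_zero
    have h₂ := Nat.cast_ne_zero (R := ℂ).2 (n + 1).succ_ne_zero
    congr 1
    push_cast at h₁ h₂ ⊢
    field_simp
    ring

theorem poisson_incl_tmul_incl (Λ : LinearMap.BilinForm ℂ V) (k l : ℕ) (x : ⨂[ℂ]^k V)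
    (y : ⨂[ℂ]^l V) : poisson Λ (incl k x ⊗ₜ incl l y) = poissonDeg Λ k l (x ⊗ₜ y) :=
  poisson_map Λ k l (x ⊗ₜ y)

theorem poisson_divPow (Λ : LinearMap.BilinForm ℂ V) (k l : ℤ) (v w : V) :
    poisson Λ (divPow k v ⊗ₜ divPow l w) =
      Λ v w • (divPow (k - 1) v ⊗ₜ[ℂ] divPow (l - 1) w) := by
  rcases lt_or_ge k 0 with hk | hk
  · simp only [divPow_of_neg hk, divPow_of_neg (show k - 1 < 0 by lia), TensorProduct.zero_tmul,
      map_zero, smul_zero]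
  rcases lt_or_ge l 0 with hl | hl
  · simp only [divPow_of_neg hl, divPow_of_neg (show l - 1 < 0 by lia), TensorProduct.tmul_zero,
      map_zero, smul_zero]
  lift k to ℕ using hk
  lift l to ℕ using hl
  rw [divPow_natCast, divPow_natCast, TensorProduct.smul_tmul_smul, map_smul,
    poisson_incl_tmul_incl]
  match k, l with
  | 0, l => simp [poissonDeg, divPow_of_neg]
  | k + 1, 0 => simp [poissonDeg, divPow_of_neg]
  | k + 1, l + 1 =>
    have hk : ((k + 1 : ℕ) : ℤ) - 1 = k := by lia
    have hl : ((l + 1 : ℕ) : ℤ) - 1 = l := by lia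
    simp only [hk, hl, divPow_natCast, TensorProduct.smul_tmul_smul, poissonDeg,
      LinearMap.smul_apply, LinearMap.comp_apply, TensorProduct.map_tmul, splitLast_tprod,
      splitFirst_tprod, pairing, LinearEquiv.coe_coe, TensorProduct.tensorTensorTensorComm_tmul,
      TensorProduct.lift.tmul, LinearMap.id_apply, TensorProduct.rid_tmul, map_smul, smul_smul,
      Nat.factorial_succ, Nat.cast_mul]
    have hk₀ := Nat.cast_ne_zero (R := ℂ).2 k.factorial_ne_zero
    have hl₀ := Nat.cast_ne_zero (R := ℂ).2 l.factorial_ne_zero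
    have hk₁ := Nat.cast_ne_zero (R := ℂ).2 k.succ_ne_zero
    have hl₁ := Nat.cast_ne_zero (R := ℂ).2 l.succ_ne_zero
    congr 1
    field_simp

variable (V) in
/-- The symmetric product `X ⊗ Y ↦ X ∨ Y`, that is `mulVee` with values in the tensor algebra. -/
def vee : Tens V ⊗[ℂ] Tens V →ₗ[ℂ] Tens V :=
  symmetrizer V ∘ₗ LinearMap.mul' ℂ (Tens V)

/-- The symmetric product of two divided powers. -/
def veePow (k l : ℤ) (v w : V) : Tens V := vee V (divPow k v ⊗ₜ divPow l w)

theorem veePow_of_neg_left {k : ℤ} (hk : k < 0) (l : ℤ) (v w : V) : veePow k l v w = 0 := by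
  rw [veePow, divPow_of_neg hk, TensorProduct.zero_tmul, map_zero]

theorem veePow_of_neg_right (k : ℤ) {l : ℤ} (hl : l < 0) (v w : V) : veePow k l v w = 0 := by
  rw [veePow, divPow_of_neg hl, TensorProduct.tmul_zero, map_zero]

theorem veePow_natCast (k l : ℕ) (v w : V) :
    veePow k l v w = ((k.factorial : ℂ)⁻¹ * (l.factorial : ℂ)⁻¹) • incl (k + l)
      (symPow (k + l) (PiTensorProduct.tprod ℂ fun i : Fin (k + l) =>
        if (i : ℕ) < k then v else w)) := by
  have happend : Fin.append (fun _ : Fin k => v) (fun _ : Fin l => w) =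
      fun i : Fin (k + l) => if (i : ℕ) < k then v else w := by
    funext i
    refine Fin.addCases (fun i => ?_) (fun i => ?_) i <;> simp
  rw [veePow, divPow_natCast, divPow_natCast, TensorProduct.smul_tmul_smul, map_smul, vee,
    LinearMap.comp_apply, LinearMap.mul'_apply, DirectSum.lof_eq_of, DirectSum.lof_eq_of,
    DirectSum.of_mul_of, TensorPower.tprod_mul_tprod, ← DirectSum.lof_eq_of ℂ, symmetrizer_incl,
    happend]

theorem symPow_permute {k : ℕ} (τ : Equiv.Perm (Fin k)) (x : ⨂[ℂ]^k V) :
    symPow k (permute τ x) = symPow k x := by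
  have h : symPow k ∘ₗ permute τ = symPow (V := V) k := by
    ext x
    simp only [LinearMap.compMultilinearMap_apply, LinearMap.comp_apply, symPow,
      LinearMap.smul_apply, LinearMap.sum_apply, permute_tprod]
    congr 1
    exact Fintype.sum_equiv (Equiv.mulLeft τ) _ _ fun σ => rfl
  exact LinearMap.congr_fun h x

theorem symPow_tprod_piecewise {n : ℕ} (T : Finset (Fin n)) (v w : V) :
    symPow n (PiTensorProduct.tprod ℂ (T.piecewise (fun _ => v) fun _ => w)) =
      symPow n (PiTensorProduct.tprod ℂ fun i : Fin n => if (i : ℕ) < T.card then v else w) := by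
  have hcard : Fintype.card {i // i ∈ T} = Fintype.card {i : Fin n // (i : ℕ) < T.card} := by
    rw [Fintype.card_coe, Fintype.card_subtype, Fin.card_filter_val_lt,
      min_eq_right (by simpa only [Fintype.card_fin] using T.card_le_univ)]
  let e := Fintype.equivOfCardEq hcard
  rw [← symPow_permute e.extendSubtype (PiTensorProduct.tprod ℂ fun i : Fin n =>
    if (i : ℕ) < T.card then v else w), permute_tprod]
  congr 2
  funext i
  by_cases hi : i ∈ T
  · rw [T.piecewise_eq_of_mem _ _ hi, if_pos (e.extendSubtype_mem i hi)]
  · rw [T.piecewise_eq_of_notMem _ _ hi, if_neg (e.extendSubtype_not_mem i hi)]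

theorem tprod_const_add (n : ℕ) (v w : V) :
    (PiTensorProduct.tprod ℂ fun _ : Fin n => v + w) =
      ∑ k ∈ Finset.range (n + 1), n.choose k • symPow n
        (PiTensorProduct.tprod ℂ fun i : Fin n => if (i : ℕ) < k then v else w) := by
  calc (PiTensorProduct.tprod ℂ fun _ : Fin n => v + w)
      = symPow n (PiTensorProduct.tprod ℂ ((fun _ => v) + fun _ => w)) :=
        (symPow_tprod_const n (v + w)).symm
    _ = ∑ T : Finset (Fin n), symPow n
          (PiTensorProduct.tprod ℂ fun i : Fin n => if (i : ℕ) < T.card then v else w) := by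
        simp only [MultilinearMap.map_add_univ, map_sum, symPow_tprod_piecewise]
    _ = _ := by
        rw [← Finset.powerset_univ, Finset.sum_powerset_apply_card fun k => symPow n
          (PiTensorProduct.tprod ℂ fun i : Fin n => if (i : ℕ) < k then v else w),
          Finset.card_univ, Fintype.card_fin]

theorem divPow_add (n : ℕ) (v w : V) :
    divPow n (v + w) = ∑ k ∈ Finset.range (n + 1), veePow k (n - k) v w := by
  rw [divPow_natCast, tprod_const_add, map_sum, Finset.smul_sum]
  refine Finset.sum_congr rfl fun k hk => ?_
  obtain ⟨l, rfl⟩ := Nat.exists_eq_add_of_le (Nat.lt_succ_iff.1 (Finset.mem_range.1 hk))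
  have hl : ((k + l : ℕ) : ℤ) - k = l := by lia
  rw [hl, veePow_natCast, ← Nat.cast_smul_eq_nsmul ℂ, map_smul, smul_smul,
    inv_factorial_add_mul_choose]

theorem divPow_smul_add (n : ℕ) (s : ℂ) (v w : V) :
    divPow n (s • v + w) = ∑ k ∈ Finset.range (n + 1), s ^ k • veePow k (n - k) v w := by
  simp only [divPow_add, veePow, divPow_smul, ← TensorProduct.smul_tmul', map_smul]

theorem sum_pow_smul_veePow_sub (n i j : ℕ) (s : ℂ) (v w : V) :
    ∑ k ∈ Finset.range (n + 1), s ^ k • veePow (k - i) (n - k - j) v w =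
      s ^ i • divPow (n - i - j) (s • v + w) := by
  rcases lt_or_ge n (i + j) with hn | hn
  · rw [divPow_of_neg (by lia), smul_zero]
    refine Finset.sum_eq_zero fun k _ => ?_
    rcases lt_or_ge k i with hk | hk
    · rw [veePow_of_neg_left (by lia), smul_zero]
    · rw [veePow_of_neg_right _ (by lia), smul_zero]
  obtain ⟨m, rfl⟩ := Nat.exists_eq_add_of_le hn
  have hm : ((i + j + m : ℕ) : ℤ) - i - j = m := by lia
  have hrange : i + j + m + 1 = i + (m + 1 + j) := by lia
  have hlow : ∀ k ∈ Finset.range i,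
      s ^ k • veePow (k - i) ((i + j + m : ℕ) - k - j) v w = 0 := fun k hk => by
    rw [veePow_of_neg_left (by have := Finset.mem_range.1 hk; lia), smul_zero]
  have hhigh : ∀ k ∈ Finset.range j, s ^ (i + (m + 1 + k)) •
      veePow ((i + (m + 1 + k) : ℕ) - i) ((i + j + m : ℕ) - (i + (m + 1 + k) : ℕ) - j) v w = 0 :=
    fun k _ => by rw [veePow_of_neg_right _ (by lia), smul_zero]
  rw [hm, divPow_smul_add, Finset.smul_sum, hrange, Finset.sum_range_add, Finset.sum_range_add,
    Finset.sum_eq_zero hlow, Finset.sum_eq_zero hhigh, zero_add, add_zero]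
  refine Finset.sum_congr rfl fun k _ => ?_
  rw [pow_add, mul_smul]
  congr 3 <;> lia

theorem laplace_divPow_smul_add {b : LinearMap.BilinForm ℂ V} (hb : ∀ v w, b v w = b w v) (n : ℕ)
    (s : ℂ) (v w : V) : laplace b (divPow n (s • v + w)) =
      ∑ k ∈ Finset.range (n + 1), s ^ k • ((b v v / 2) • veePow (k - 2) (n - k) v w +
        (b w w / 2) • veePow k (n - k - 2) v w + b v w • veePow (k - 1) (n - k - 1) v w) := by
  have hleft := sum_pow_smul_veePow_sub n 2 0 s v w
  have hright := sum_pow_smul_veePow_sub n 0 2 s v w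
  have hmixed := sum_pow_smul_veePow_sub n 1 1 s v w
  have hn : (n : ℤ) - 1 - 1 = n - 2 := by lia
  simp only [Nat.cast_zero, Nat.cast_one, Nat.cast_ofNat, sub_zero, pow_zero, pow_one, one_smul,
    hn] at hleft hright hmixed
  simp only [smul_add, smul_comm (s ^ _), Finset.sum_add_distrib, ← Finset.smul_sum, hleft, hright,
    hmixed]
  rw [laplace_divPow, smul_smul, smul_smul, ← add_smul, ← add_smul]
  congr 1
  simp only [map_add, map_smul, LinearMap.add_apply, LinearMap.smul_apply, smul_eq_mul, hb w v]
  ring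

theorem laplace_veePow {b : LinearMap.BilinForm ℂ V} (hb : ∀ v w, b v w = b w v) (k l : ℤ)
    (v w : V) : laplace b (veePow k l v w) =
      (b v v / 2) • veePow (k - 2) l v w + (b w w / 2) • veePow k (l - 2) v w +
        b v w • veePow (k - 1) (l - 1) v w := by
  rcases lt_or_ge k 0 with hk | hk
  · simp [veePow_of_neg_left hk, veePow_of_neg_left (show k - 2 < 0 by lia),
      veePow_of_neg_left (show k - 1 < 0 by lia)]
  rcases lt_or_ge l 0 with hl | hl
  · simp [veePow_of_neg_right _ hl, veePow_of_neg_right _ (show l - 2 < 0 by lia),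
      veePow_of_neg_right _ (show l - 1 < 0 by lia)]
  lift k to ℕ using hk
  lift l to ℕ using hl
  have hsum := fun s => (congrArg (laplace b) (divPow_smul_add (k + l) s v w)).symm.trans
    (laplace_divPow_smul_add hb (k + l) s v w)
  simp only [map_sum, map_smul] at hsum
  have hk := eq_of_forall_sum_pow_smul_eq hsum (k := k) (by lia)
  rwa [show ((k + l : ℕ) : ℤ) - k = l by lia] at hk

end DividedPowers

section StarProduct

variable {V : Type*} [AddCommGroup V] [Module ℂ V]

variable (V) in
/-- The span of the tensor products of divided powers. It contains `𝒮(V) ⊗ 𝒮(V)`, and on it the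
operators `P_Λ` for different `Λ` commute, which they do not on all of `𝒯(V) ⊗ 𝒯(V)`. -/
def divPowSpan : Submodule ℂ (Tens V ⊗[ℂ] Tens V) :=
  Submodule.span ℂ (Set.range fun p : (ℤ × V) × (ℤ × V) =>
    divPow p.1.1 p.1.2 ⊗ₜ[ℂ] divPow p.2.1 p.2.2)

/-- The tensor product of two divided powers, as an element of `divPowSpan V`. -/
def divPowTmul (k l : ℤ) (v w : V) : divPowSpan V :=
  ⟨divPow k v ⊗ₜ divPow l w, Submodule.subset_span ⟨((k, v), (l, w)), rfl⟩⟩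

theorem coe_divPowTmul (k l : ℤ) (v w : V) :
    (divPowTmul k l v w : Tens V ⊗[ℂ] Tens V) = divPow k v ⊗ₜ divPow l w := rfl

theorem divPowSpan_hom_ext {M : Type*} [AddCommMonoid M] [Module ℂ M]
    {S T : divPowSpan V →ₗ[ℂ] M}
    (h : ∀ k l v w, S (divPowTmul k l v w) = T (divPowTmul k l v w)) : S = T := by
  refine LinearMap.ext_on Submodule.span_span_coe_preimage ?_
  rintro ⟨_, _⟩ ⟨p, rfl⟩
  exact h p.1.1 p.2.1 p.1.2 p.2.2

theorem tmul_mem_divPowSpan {X Y : Tens V} (hX : X ∈ SymTens V) (hY : Y ∈ SymTens V) :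
    X ⊗ₜ[ℂ] Y ∈ divPowSpan V := by
  have h := Submodule.apply_mem_map₂ (TensorProduct.mk ℂ (Tens V) (Tens V))
    (symTens_le_span_divPow hX) (symTens_le_span_divPow hY)
  rw [Submodule.map₂_span_span] at h
  refine Submodule.span_mono ?_ h
  rintro _ ⟨_, ⟨p, rfl⟩, _, ⟨q, rfl⟩, rfl⟩
  exact ⟨(p, q), rfl⟩

theorem map_mem_divPowSpan {T : Tens V ⊗[ℂ] Tens V →ₗ[ℂ] Tens V ⊗[ℂ] Tens V}
    (hT : ∀ k l v w, T (divPow k v ⊗ₜ divPow l w) ∈ divPowSpan V) :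
    ∀ Z ∈ divPowSpan V, T Z ∈ divPowSpan V := by
  refine fun Z hZ => (Submodule.map_span_le T _ _).2 ?_ (Submodule.mem_map_of_mem hZ)
  rintro _ ⟨p, rfl⟩
  exact hT _ _ _ _

/-- The operator `Δ_b ⊗ 1` on `divPowSpan V`. -/
def laplaceLeft (b : LinearMap.BilinForm ℂ V) : divPowSpan V →ₗ[ℂ] divPowSpan V :=
  (LinearMap.rTensor (Tens V) (laplace b)).restrict <| map_mem_divPowSpan fun k l v w => by
    rw [LinearMap.rTensor_tmul, laplace_divPow, ← TensorProduct.smul_tmul']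
    exact Submodule.smul_mem _ _ (divPowTmul _ _ _ _).2

/-- The operator `1 ⊗ Δ_b` on `divPowSpan V`. -/
def laplaceRight (b : LinearMap.BilinForm ℂ V) : divPowSpan V →ₗ[ℂ] divPowSpan V :=
  (LinearMap.lTensor (Tens V) (laplace b)).restrict <| map_mem_divPowSpan fun k l v w => by
    rw [LinearMap.lTensor_tmul, laplace_divPow, TensorProduct.tmul_smul]
    exact Submodule.smul_mem _ _ (divPowTmul _ _ _ _).2

/-- The operator `P_Λ` on `divPowSpan V`. -/
def poissonSpan (Λ : LinearMap.BilinForm ℂ V) : divPowSpan V →ₗ[ℂ] divPowSpan V :=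
  (poisson Λ).restrict <| map_mem_divPowSpan fun k l v w => by
    rw [poisson_divPow]
    exact Submodule.smul_mem _ _ (divPowTmul _ _ _ _).2

theorem laplaceLeft_divPowTmul (b : LinearMap.BilinForm ℂ V) (k l : ℤ) (v w : V) :
    laplaceLeft b (divPowTmul k l v w) = (b v v / 2) • divPowTmul (k - 2) l v w :=
  Subtype.ext <| (LinearMap.rTensor_tmul _ _ _ _).trans <| by
    rw [laplace_divPow, ← TensorProduct.smul_tmul', Submodule.coe_smul, coe_divPowTmul]

theorem laplaceRight_divPowTmul (b : LinearMap.BilinForm ℂ V) (k l : ℤ) (v w : V) :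
    laplaceRight b (divPowTmul k l v w) = (b w w / 2) • divPowTmul k (l - 2) v w :=
  Subtype.ext <| (LinearMap.lTensor_tmul _ _ _ _).trans <| by
    rw [laplace_divPow, TensorProduct.tmul_smul, Submodule.coe_smul, coe_divPowTmul]

theorem poissonSpan_divPowTmul (Λ : LinearMap.BilinForm ℂ V) (k l : ℤ) (v w : V) :
    poissonSpan Λ (divPowTmul k l v w) = Λ v w • divPowTmul (k - 1) (l - 1) v w :=
  Subtype.ext (poisson_divPow Λ k l v w)

theorem commute_laplaceLeft_laplaceRight (b b' : LinearMap.BilinForm ℂ V) :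
    Commute (laplaceLeft b) (laplaceRight b') :=
  divPowSpan_hom_ext fun k l v w => by
    simp only [Module.End.mul_apply, laplaceLeft_divPowTmul, laplaceRight_divPowTmul, map_smul,
      smul_smul, mul_comm]

theorem commute_laplaceLeft_poissonSpan (b Λ : LinearMap.BilinForm ℂ V) :
    Commute (laplaceLeft b) (poissonSpan Λ) :=
  divPowSpan_hom_ext fun k l v w => by
    simp only [Module.End.mul_apply, laplaceLeft_divPowTmul, poissonSpan_divPowTmul, map_smul,
      smul_smul, mul_comm, sub_right_comm]

theorem commute_laplaceRight_poissonSpan (b Λ : LinearMap.BilinForm ℂ V) :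
    Commute (laplaceRight b) (poissonSpan Λ) :=
  divPowSpan_hom_ext fun k l v w => by
    simp only [Module.End.mul_apply, laplaceRight_divPowTmul, poissonSpan_divPowTmul, map_smul,
      smul_smul, mul_comm, sub_right_comm]

theorem commute_poissonSpan (Λ Λ' : LinearMap.BilinForm ℂ V) :
    Commute (poissonSpan Λ) (poissonSpan Λ') :=
  divPowSpan_hom_ext fun k l v w => by
    simp only [Module.End.mul_apply, poissonSpan_divPowTmul, map_smul, smul_smul, mul_comm]

theorem poissonSpan_add (Λ Λ' : LinearMap.BilinForm ℂ V) :
    poissonSpan (Λ + Λ') = poissonSpan Λ + poissonSpan Λ' :=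
  divPowSpan_hom_ext fun k l v w => by
    simp only [LinearMap.add_apply, poissonSpan_divPowTmul, add_smul]

theorem laplace_comp_vee {b : LinearMap.BilinForm ℂ V} (hb : ∀ v w, b v w = b w v) :
    laplace b ∘ₗ vee V ∘ₗ (divPowSpan V).subtype =
      (vee V ∘ₗ (divPowSpan V).subtype) ∘ₗ (laplaceLeft b + (laplaceRight b + poissonSpan b)) :=
  divPowSpan_hom_ext fun k l v w => by
    simp only [LinearMap.comp_apply, LinearMap.add_apply, laplaceLeft_divPowTmul,
      laplaceRight_divPowTmul, poissonSpan_divPowTmul, map_add, map_smul, Submodule.subtype_apply,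
      coe_divPowTmul]
    exact (laplace_veePow hb k l v w).trans (add_assoc _ _ _)

theorem laplaceLeft_locallyNilpotent (b : LinearMap.BilinForm ℂ V) :
    LocallyNilpotent (laplaceLeft b) :=
  (laplace_locallyNilpotent b).rTensor.restrict _

theorem laplaceRight_locallyNilpotent (b : LinearMap.BilinForm ℂ V) :
    LocallyNilpotent (laplaceRight b) :=
  (laplace_locallyNilpotent b).lTensor.restrict _

theorem poissonSpan_locallyNilpotent (Λ : LinearMap.BilinForm ℂ V) :
    LocallyNilpotent (poissonSpan Λ) :=
  (poisson_locallyNilpotent Λ).restrict _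

theorem coe_exp_poissonSpan (Λ : LinearMap.BilinForm ℂ V) (Z : divPowSpan V) :
    ((poissonSpan_locallyNilpotent Λ).exp Z : Tens V ⊗[ℂ] Tens V) =
      (poisson_locallyNilpotent Λ).exp Z :=
  (poisson_locallyNilpotent Λ).coe_exp_restrict _ Z

theorem coe_exp_laplaceLeft_exp_laplaceRight_tmul (b : LinearMap.BilinForm ℂ V)
    {X Y : Tens V} (h : X ⊗ₜ[ℂ] Y ∈ divPowSpan V) :
    ((laplaceLeft_locallyNilpotent b).exp ((laplaceRight_locallyNilpotent b).exp ⟨X ⊗ₜ Y, h⟩) :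
      Tens V ⊗[ℂ] Tens V) = expLaplace b X ⊗ₜ expLaplace b Y :=
  calc _ = (laplace_locallyNilpotent b).rTensor.exp
        ((laplaceRight_locallyNilpotent b).exp ⟨X ⊗ₜ Y, h⟩) :=
        (laplace_locallyNilpotent b).rTensor.coe_exp_restrict _ _
    _ = (laplace_locallyNilpotent b).rTensor.exp
        ((laplace_locallyNilpotent b).lTensor.exp (X ⊗ₜ Y)) :=
        congrArg _ ((laplace_locallyNilpotent b).lTensor.coe_exp_restrict _ _)
    _ = _ := by rw [LocallyNilpotent.exp_lTensor_tmul, LocallyNilpotent.exp_rTensor_tmul]; rfl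

theorem expLaplace_vee {b : LinearMap.BilinForm ℂ V} (hb : ∀ v w, b v w = b w v)
    (Z : divPowSpan V) :
    expLaplace b (vee V Z) = vee V ((laplaceLeft_locallyNilpotent b).exp
      ((laplaceRight_locallyNilpotent b).exp ((poissonSpan_locallyNilpotent b).exp Z))) := by
  have hRP := commute_laplaceRight_poissonSpan b b
  have hLRP := (commute_laplaceLeft_laplaceRight b b).add_right
    (commute_laplaceLeft_poissonSpan b b)
  rw [← LocallyNilpotent.exp_add _ _ hRP, ← LocallyNilpotent.exp_add _ _ hLRP]
  exact LocallyNilpotent.exp_apply_of_comp_eq _ _ (laplace_comp_vee hb) Z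

theorem exp_poissonSpan_exp_poissonSpan (Λ Λ' : LinearMap.BilinForm ℂ V) (Z : divPowSpan V) :
    (poissonSpan_locallyNilpotent Λ').exp ((poissonSpan_locallyNilpotent Λ).exp Z) =
      (poissonSpan_locallyNilpotent (Λ + Λ')).exp Z := by
  rw [← LocallyNilpotent.exp_add _ _ (commute_poissonSpan Λ' Λ)]
  simp only [poissonSpan_add, add_comm]

-- All operators in the exponents commute, and `P_Λ + P_b = P_{Λ+b}`:
-- `e^{Δ_b} ∘ ∨ ∘ e^{P_Λ} = ∨ ∘ e^{Δ_b ⊗ 1 + 1 ⊗ Δ_b + P_b} e^{P_Λ}`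
-- `= ∨ ∘ e^{P_{Λ+b}} (e^{Δ_b} ⊗ e^{Δ_b})`.
theorem expLaplaceSym_starProd {b : LinearMap.BilinForm ℂ V} (hb : ∀ v w, b v w = b w v)
    (Λ : LinearMap.BilinForm ℂ V) (X Y : SymTens V) :
    expLaplaceSym b (starProd Λ X Y) =
      starProd (Λ + b) (expLaplaceSym b X) (expLaplaceSym b Y) := by
  let Z : divPowSpan V := ⟨X ⊗ₜ Y, tmul_mem_divPowSpan X.2 Y.2⟩
  let L := laplaceLeft_locallyNilpotent b
  let R := laplaceRight_locallyNilpotent b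
  let P := poissonSpan_locallyNilpotent (V := V)
  refine Subtype.ext ?_
  calc expLaplace b (vee V ((poisson_locallyNilpotent Λ).exp Z))
      = vee V (L.exp (R.exp ((P b).exp ((P Λ).exp Z)))) := by
        rw [← coe_exp_poissonSpan, expLaplace_vee hb]
    _ = vee V (L.exp (R.exp ((P (Λ + b)).exp Z))) := by rw [exp_poissonSpan_exp_poissonSpan]
    _ = vee V ((P (Λ + b)).exp (L.exp (R.exp Z))) := by
        rw [R.exp_comm _ (commute_laplaceRight_poissonSpan b _),
          L.exp_comm _ (commute_laplaceLeft_poissonSpan b _)]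
    _ = vee V ((poisson_locallyNilpotent (Λ + b)).exp (expLaplace b X ⊗ₜ expLaplace b Y)) := by
        rw [coe_exp_poissonSpan, coe_exp_laplaceLeft_exp_laplaceRight_tmul]

end StarProduct

section Inverse

variable {V : Type*} [AddCommGroup V] [Module ℂ V]

theorem contractFirst_neg (b : LinearMap.BilinForm ℂ V) (k : ℕ) :
    contractFirst (-b) k = -contractFirst b k := by
  ext x
  simp [contractFirst_tprod]

theorem laplace_neg (b : LinearMap.BilinForm ℂ V) : laplace (-b) = -laplace b := by
  refine LinearMap.ext fun X => ?_
  ext k : 1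
  rw [laplace_apply, contractFirst_neg, LinearMap.neg_apply, smul_neg, ← laplace_apply]
  rfl

theorem expLaplaceSym_neg_apply (b : LinearMap.BilinForm ℂ V) (X : SymTens V) :
    expLaplaceSym b (expLaplaceSym (-b) X) = X := by
  refine Subtype.ext ?_
  change (laplace_locallyNilpotent b).exp ((laplace_locallyNilpotent (-b)).exp X) = X
  simp only [laplace_neg, LocallyNilpotent.exp_exp_neg]

/-- The operator `e^{Δ_b}` as a linear homeomorphism of the space of symmetric tensors. -/
def IsHilbertSchmidt.expLaplaceEquiv [TopologicalSpace V] {b : LinearMap.BilinForm ℂ V}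
    (hb : IsHilbertSchmidt b) : SymTens V ≃L[ℂ] SymTens V where
  toLinearEquiv := LinearEquiv.ofLinearMap (expLaplaceSym b) (expLaplaceSym (-b))
    (LinearMap.ext fun X => expLaplaceSym_neg_apply b X)
    (LinearMap.ext fun X => by simpa using expLaplaceSym_neg_apply (-b) X)
  continuous_toFun := continuous_expLaplaceSym hb.continuous_expLaplace
  continuous_invFun := continuous_expLaplaceSym hb.neg.continuous_expLaplace

end Inverse

end HilbertTensor

end

theorem theorem3p10_general {V : Type*} [AddCommGroup V] [Module ℂ V] [TopologicalSpace V]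
    (b : LinearMap.BilinForm ℂ V) (hb : ∀ v w, b v w = b w v) :
    (Continuous (HilbertTensor.expLaplace b) ↔ HilbertTensor.IsHilbertSchmidt b) ∧
    (Continuous (HilbertTensor.expLaplaceSym b) ↔ HilbertTensor.IsHilbertSchmidt b) ∧
    (HilbertTensor.IsHilbertSchmidt b →
      (∀ Λ : LinearMap.BilinForm ℂ V, Continuous (fun p : V × V => Λ p.1 p.2) →
        Continuous (fun p : V × V => (Λ + b) p.1 p.2) ∧
        (∀ X Y : HilbertTensor.SymTens V,
          HilbertTensor.expLaplaceSym b (HilbertTensor.starProd Λ X Y) =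
            HilbertTensor.starProd (Λ + b)
              (HilbertTensor.expLaplaceSym b X) (HilbertTensor.expLaplaceSym b Y)) ∧
        ∃ φ : HilbertTensor.SymTens V ≃L[ℂ] HilbertTensor.SymTens V,
          (∀ X, φ X = HilbertTensor.expLaplaceSym b X) ∧
          ∀ X Y, φ (HilbertTensor.starProd Λ X Y) =
            HilbertTensor.starProd (Λ + b) (φ X) (φ Y)) ∧
      ∃ D : HilbertTensor.SymCpl V →L[ℂ] HilbertTensor.SymCpl V,
        (∀ X : HilbertTensor.SymTens V,
          D X = (HilbertTensor.laplaceSym b X : HilbertTensor.SymTens V)) ∧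
        ∀ X : HilbertTensor.SymCpl V, ∃ F : ℂ → HilbertTensor.SymCpl V,
          (∀ q : Seminorm ℂ (HilbertTensor.SymCpl V), Continuous q →
            ∀ z : ℂ, Summable fun t : ℕ => q ((z ^ t / (t.factorial : ℂ)) • (D ^ t) X)) ∧
          (∀ z : ℂ, HasSum (fun t : ℕ => (z ^ t / (t.factorial : ℂ)) • (D ^ t) X) (F z)) ∧
          TendstoLocallyUniformly
            (fun (N : ℕ) (z : ℂ) =>
              ∑ t ∈ Finset.range N, (z ^ t / (t.factorial : ℂ)) • (D ^ t) X)
            F Filter.atTop ∧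
          Differentiable ℂ F) := by
  have of_sym := HilbertTensor.isHilbertSchmidt_of_continuous hb
  have continuous_exp : HilbertTensor.IsHilbertSchmidt b →
      Continuous (HilbertTensor.expLaplace b) := fun h => h.continuous_expLaplace
  refine ⟨⟨fun h => of_sym (HilbertTensor.continuous_expLaplaceSym h), continuous_exp⟩,
    ⟨of_sym, fun h => HilbertTensor.continuous_expLaplaceSym (continuous_exp h)⟩, fun h => ⟨?_, ?_⟩⟩
  · have intertwines := HilbertTensor.expLaplaceSym_starProd hb
    exact fun Λ hΛ => ⟨hΛ.add h.continuous_apply, intertwines Λ, h.expLaplaceEquiv,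
      fun _ => rfl, intertwines Λ⟩
  · have continuous_laplace := HilbertTensor.continuous_laplaceSym h.continuous_laplace
    exact ⟨HilbertTensor.laplaceCpl continuous_laplace, HilbertTensor.laplaceCpl_coe _,
      h.exists_laplace_exp_series _⟩

theorem theorem3p10 {V : Type*} [AddCommGroup V] [Module ℂ V] [TopologicalSpace V] [T2Space V]
    (hV : WithSeminorms (HilbertTensor.hilbertSeminorms V))
    (b : LinearMap.BilinForm ℂ V) (hb : ∀ v w, b v w = b w v) :
    (Continuous (HilbertTensor.expLaplace b) ↔ HilbertTensor.IsHilbertSchmidt b) ∧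
    (Continuous (HilbertTensor.expLaplaceSym b) ↔ HilbertTensor.IsHilbertSchmidt b) ∧
    (HilbertTensor.IsHilbertSchmidt b →
      (∀ Λ : LinearMap.BilinForm ℂ V, Continuous (fun p : V × V => Λ p.1 p.2) →
        Continuous (fun p : V × V => (Λ + b) p.1 p.2) ∧
        (∀ X Y : HilbertTensor.SymTens V,
          HilbertTensor.expLaplaceSym b (HilbertTensor.starProd Λ X Y) =
            HilbertTensor.starProd (Λ + b)
              (HilbertTensor.expLaplaceSym b X) (HilbertTensor.expLaplaceSym b Y)) ∧
        ∃ φ : HilbertTensor.SymTens V ≃L[ℂ] HilbertTensor.SymTens V,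
          (∀ X, φ X = HilbertTensor.expLaplaceSym b X) ∧
          ∀ X Y, φ (HilbertTensor.starProd Λ X Y) =
            HilbertTensor.starProd (Λ + b) (φ X) (φ Y)) ∧
      ∃ D : HilbertTensor.SymCpl V →L[ℂ] HilbertTensor.SymCpl V,
        (∀ X : HilbertTensor.SymTens V, D X = (HilbertTensor.laplaceSym b X : HilbertTensor.SymTens V)) ∧
        ∀ X : HilbertTensor.SymCpl V, ∃ F : ℂ → HilbertTensor.SymCpl V,
          (∀ q : Seminorm ℂ (HilbertTensor.SymCpl V), Continuous q →
            ∀ z : ℂ, Summable fun t : ℕ => q ((z ^ t / (t.factorial : ℂ)) • (D ^ t) X)) ∧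
          (∀ z : ℂ, HasSum (fun t : ℕ => (z ^ t / (t.factorial : ℂ)) • (D ^ t) X) (F z)) ∧
          TendstoLocallyUniformly
            (fun (N : ℕ) (z : ℂ) =>
              ∑ t ∈ Finset.range N, (z ^ t / (t.factorial : ℂ)) • (D ^ t) X)
            F Filter.atTop ∧
          Differentiable ℂ F) :=
  theorem3p10_general b hb
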